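/- Let $c_0,\dots,c_{n-1}$ be real numbers with $c_k\ge 0$ for $0\le k\le n-2$ and $\sum_{k=0}^{n-2}c_k>0$ (so $n\ge 2$; $c_{n-1}\in\mathbb R$ is arbitrary), and let $$f(\lambda)=\lambda_1\cdots\lambda_n+c_{n-1}\sigma_{n-1}(\lambda)-\sum_{k=0}^{n-2}c_k\sigma_k(\lambda),\qquad \lambda\in\mathbb R^n,$$ where $\sigma_k$ is the $k$-th elementary symmetric polynomial ($\sigma_0=1$). Let $\Gamma_n=\{\lambda:\lambda_i>0\ \forall i\}$ be the positive orthant. Then the level set $\{f=0\}$, understood as its connected component contained in a translate $q+\Gamma_n$, is convex. Precisely: (1) The polynomial $r_f(x)=f(x,\dots,x)$ is strictly right-Noetherian, that is, for each $k\in\{0,\dots,n-1\}$ the derivative $r_f^{(k)}$ has a real root greater than or equal to all real roots of $r_f^{(k+1)}$, and the largest real root $x_0$ of $r_f$ is strictly greater than all real roots of $r_f'$. Moreover $x_0>0$. (2) There is exactly one connected component $\Gamma$ of $\{f>0\}$ with $\Gamma\subseteq q+\Gamma_n$ for some $q\in\mathbb R^n$. It is strictly $\Upsilon$-stable: $\partial\Gamma\subseteq\Upsilon_1$,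 where $\Upsilon_1$ is the set of $\mu\in\mathbb R^n$ such that for every permutation $s$ of $\{1,\dots,n\}$ the point $(\mu_{s(1)},\dots,\mu_{s(n-1)})$ lies in the projection of $\Gamma$ to the first $n-1$ coordinates. (3) The boundary $\partial\Gamma$ is a connected component of $\{f=0\}$, and it is the only one that is contained in $q+\Gamma_n$ for some $q\in\mathbb R^n$. (4) This level set $\partial\Gamma$ is a convex hypersurface: the region $\Gamma$ that it bounds is convex. -/

import Mathlib

noncomputable section

/-- The multilinear polynomial `λ₁⋯λₙ + c_{n-1} σ_{n-1}(λ) - ∑_{k=0}^{n-2} c_k σ_k(λ)`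
(for `n ≥ 1`), where `σ_k` is the `k`-th elementary symmetric polynomial. -/
def guanZhangPoly (n : ℕ) (c : ℕ → ℝ) : MvPolynomial (Fin n) ℝ :=
  (∏ i, MvPolynomial.X i) + MvPolynomial.C (c (n - 1)) * MvPolynomial.esymm (Fin n) ℝ (n - 1)
    - ∑ k ∈ Finset.range (n - 1), MvPolynomial.C (c k) * MvPolynomial.esymm (Fin n) ℝ k

/-- The set `{f = 0}`. -/
def zeroSet {n : ℕ} (f : MvPolynomial (Fin n) ℝ) : Set (Fin n → ℝ) :=
  {x | MvPolynomial.eval x f = 0}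

/-- The set `{f > 0}`. -/
def positiveSet {n : ℕ} (f : MvPolynomial (Fin n) ℝ) : Set (Fin n → ℝ) :=
  {x | 0 < MvPolynomial.eval x f}

/-- `C` is a connected component of the subset `S` (in particular, `C` is nonempty). -/
def IsComponentOf {n : ℕ} (C S : Set (Fin n → ℝ)) : Prop :=
  ∃ x ∈ S, C = connectedComponentIn S x

/-- `C ⊆ q + Γₙ` for some `q`, where `Γₙ` is the open positive orthant. -/
def InOrthantTranslate {n : ℕ} (C : Set (Fin n → ℝ)) : Prop :=
  ∃ q : Fin n → ℝ, ∀ x ∈ C, ∀ i, q i < x i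

/-- The cone `Υ₁` of `Γ`: the points `μ` such that for every permutation `s`, the tuple
`(μ_{s(1)}, …, μ_{s(n-1)})` lies in the projection of `Γ` that drops the last entry. -/
def upsilonOne {n : ℕ} (Γ : Set (Fin n → ℝ)) : Set (Fin n → ℝ) :=
  {μ | ∀ s : Equiv.Perm (Fin n), ∃ x ∈ Γ, ∀ i : Fin n, (i : ℕ) + 1 < n → x i = μ (s i)}

/-- `Γ` is an `Υ`-stable connected component of `{f > 0}`. -/
def IsUpsilonStable {n : ℕ} (f : MvPolynomial (Fin n) ℝ) (Γ : Set (Fin n → ℝ)) : Prop :=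
  IsComponentOf Γ (positiveSet f) ∧ InOrthantTranslate Γ

/-- `Γ` is a strictly `Υ`-stable connected component of `{f > 0}`. -/
def IsStrictlyUpsilonStable {n : ℕ} (f : MvPolynomial (Fin n) ℝ) (Γ : Set (Fin n → ℝ)) : Prop :=
  IsUpsilonStable f Γ ∧ frontier Γ ⊆ upsilonOne Γ

/-- The diagonal restriction `r_f(x) = f(x, …, x)`. -/
def diagonalRestriction {n : ℕ} (f : MvPolynomial (Fin n) ℝ) : Polynomial ℝ :=
  MvPolynomial.aeval (fun _ => (Polynomial.X : Polynomial ℝ)) f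

/-- For each `k < deg p`, the `k`-th derivative of `p` has a real root that is at least every
real root of the `(k+1)`-st derivative. -/
def IsRightNoetherian (p : Polynomial ℝ) : Prop :=
  ∀ k < p.natDegree, ∃ x, (Polynomial.derivative^[k] p).IsRoot x ∧
    ∀ y, (Polynomial.derivative^[k + 1] p).IsRoot y → y ≤ x

/-- Right-Noetherian, and the largest real root of `p` exceeds every real root of `p'`. -/
def IsStrictlyRightNoetherian (p : Polynomial ℝ) : Prop :=
  IsRightNoetherian p ∧
    ∃ x, p.IsRoot x ∧ ∀ y, (Polynomial.derivative p).IsRoot y → y < x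

end

/-! Write p_T for the elementary symmetric polynomial of degree #T - 1 in the variables of T, and
h_T for the product over T divided by p_T. Each σ_k with k ≤ n-2 is a positive multiple of the sum
of p_U over #U = k+1, so f = ∏ x_i + c p_univ - ∑ a_U p_U with a_U ≥ 0. Inserting an index factors
p_{T∪i} = p_T (x_i + h_T), and h_{T∪i} is the parallel sum of x_i and h_T (`parallelSum_insert`). On
the cone where all p_T with T nonempty are positive, the parallel sum is a minimum of linear forms
with nonnegative coefficients, so every h_T is concave and increasing. Hence p_U/p_univ is a product
of reciprocals of positive concave functions, thus log-convex and convex. So f/p_univ is concave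
(`concaveOn_combQuotient`), and the part Γ of {f > 0} in the cone is convex. Positivity of f bounds
the factors x_i + h_T away from 0 on bounded sets, so the closure of Γ stays in the cone
(`closure_positiveRegion_subset`). This makes Γ a full component of {f > 0} and its frontier the
zero set of f in the cone; the frontier is connected because Γ is an upper set bounded below.
Uniqueness uses only that f is affine in each variable: a component bounded below can contain no
path along which a coordinate tends to -∞. This fixes the signs of the slopes and forces the
component to meet Γ or its frontier. The diagonal claims are separate: p(x)/x^(n-1) is strictly
increasing on x > 0 for p = r_f. -/

/-! ### One variable: root order of polynomials with nonpositive low coefficients -/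

/-- Real polynomials of degree `m` with positive leading coefficient all of whose coefficients
of index at most `m - 2` are nonpositive. -/
structure IsSignedPoly (m : ℕ) (p : Polynomial ℝ) : Prop where
  natDegree_eq : p.natDegree = m
  lead_pos : 0 < p.coeff m
  coeff_nonpos : ∀ j, j + 2 ≤ m → p.coeff j ≤ 0

namespace IsSignedPoly

open Polynomial

theorem derivative {m : ℕ} {p : ℝ[X]} (h : IsSignedPoly (m + 1) p) :
    IsSignedPoly m (derivative p) where
  natDegree_eq := by
    rw [natDegree_derivative, h.natDegree_eq]; rfl
  lead_pos := by
    rw [coeff_derivative]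
    exact mul_pos h.lead_pos (by positivity)
  coeff_nonpos j hj := by
    rw [coeff_derivative]
    exact mul_nonpos_of_nonpos_of_nonneg (h.coeff_nonpos _ (by omega)) (by positivity)

theorem iterate_derivative {m : ℕ} (k : ℕ) {p : ℝ[X]} (h : IsSignedPoly (m + k) p) :
    IsSignedPoly m (Polynomial.derivative^[k] p) := by
  induction k generalizing p with
  | zero => exact h
  | succ k ih =>
    rw [Function.iterate_succ_apply]
    exact ih (IsSignedPoly.derivative (by rwa [← add_assoc] at h))

/-- In x p' - m p the coefficient p_j is multiplied by j - m. This is a product of nonpositive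
factors for j < m, kills the coefficient of free sign at j = m, and is positive at j = m + 1. -/
theorem mul_eval_lt_mul_eval_derivative {m : ℕ} {p : ℝ[X]} (h : IsSignedPoly (m + 1) p) {x : ℝ}
    (hx : 0 < x) : m * p.eval x < x * (Polynomial.derivative p).eval x := by
  have h1 : p.eval x = ∑ i ∈ Finset.range (m + 2), p.coeff i * x ^ i :=
    eval_eq_sum_range' (by rw [h.natDegree_eq]; omega) x
  have h2 : x * (Polynomial.derivative p).eval x
      = ∑ i ∈ Finset.range (m + 2), (i : ℝ) * (p.coeff i * x ^ i) := by
    rw [eval_eq_sum_range' (n := m + 1) (by rw [h.derivative.natDegree_eq]; omega) x,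
      Finset.sum_range_succ' _ (m + 1), Finset.mul_sum]
    simp only [CharP.cast_eq_zero, zero_mul, add_zero]
    refine Finset.sum_congr rfl fun i _ => ?_
    rw [coeff_derivative]; push_cast; ring
  rw [h1, h2, Finset.mul_sum]
  refine Finset.sum_lt_sum (fun i hi => ?_) ⟨m + 1, by simp, ?_⟩
  · rcases lt_trichotomy i m with hlt | rfl | hlt
    · have : (i : ℝ) ≤ m := by exact_mod_cast hlt.le
      exact mul_le_mul_of_nonpos_right this
        (mul_nonpos_of_nonpos_of_nonneg (h.coeff_nonpos i (by omega)) (by positivity))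
    · exact le_rfl
    · obtain rfl : i = m + 1 := by simp at hi; omega
      have := mul_pos h.lead_pos (pow_pos hx (m + 1))
      push_cast; nlinarith
  · have := mul_pos h.lead_pos (pow_pos hx (m + 1))
    push_cast; nlinarith

theorem derivative_pos {m : ℕ} {p : ℝ[X]} (h : IsSignedPoly (m + 1) p) {x : ℝ}
    (hx : 0 < x) (hp : 0 ≤ p.eval x) : 0 < (Polynomial.derivative p).eval x := by
  have h1 := h.mul_eval_lt_mul_eval_derivative hx
  have h2 : (0 : ℝ) ≤ m * p.eval x := by positivity
  exact pos_of_mul_pos_right (h2.trans_lt h1) hx.le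

theorem tendsto_atTop {m : ℕ} {p : ℝ[X]} (h : IsSignedPoly (m + 1) p) :
    Filter.Tendsto (fun x => p.eval x) Filter.atTop Filter.atTop := by
  refine Polynomial.tendsto_atTop_of_leadingCoeff_nonneg p ?_ ?_
  · rw [← natDegree_pos_iff_degree_pos, h.natDegree_eq]; omega
  · rw [leadingCoeff, h.natDegree_eq]; exact h.lead_pos.le

/-- Beyond a positive root the polynomial is positive. -/
theorem pos_of_root_lt {m : ℕ} {p : ℝ[X]} (h : IsSignedPoly (m + 1) p) {x y : ℝ}
    (hx : 0 < x) (hp : p.eval x = 0) (hxy : x < y) : 0 < p.eval y := by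
  -- `p(t) / t ^ m` is strictly increasing on the positive half-line
  have hmono : StrictMonoOn (fun t => p.eval t / t ^ m) (Set.Ioi 0) := by
    refine strictMonoOn_of_deriv_pos (convex_Ioi 0) ?_ ?_
    · exact ContinuousOn.div p.continuousOn (by fun_prop) fun t ht => (pow_pos ht m).ne'
    · intro t ht
      rw [interior_Ioi] at ht
      have ht' : (0 : ℝ) < t := ht
      have hd := (p.hasDerivAt t).div (hasDerivAt_pow m t) (pow_pos ht' m).ne'
      have hd' : deriv (fun t => p.eval t / t ^ m) t = _ := hd.deriv
      rw [hd']
      refine div_pos ?_ (by positivity)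
      have h1 := h.mul_eval_lt_mul_eval_derivative ht'
      cases m with
      | zero => simp at h1 ⊢; exact pos_of_mul_pos_right h1 ht'.le
      | succ m =>
        have : 0 < t ^ m := pow_pos ht' m
        simp only [Nat.add_sub_cancel]
        rw [pow_succ]
        nlinarith
  have := hmono hx (hx.trans hxy : (0:ℝ) < y) hxy
  simp only [hp, zero_div] at this
  exact (div_pos_iff_of_pos_right (pow_pos (hx.trans hxy) m)).1 this

theorem exists_root_ge {m : ℕ} {p : ℝ[X]} (h : IsSignedPoly (m + 1) p) :
    ∃ x, p.IsRoot x ∧ ∀ y, (Polynomial.derivative p).IsRoot y → y ≤ x := by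
  by_cases hroot : ∃ x, 0 < x ∧ p.eval x = 0
  · obtain ⟨x, hx, hp⟩ := hroot
    refine ⟨x, hp, fun y hy => ?_⟩
    by_contra! hlt
    exact (h.derivative_pos (hx.trans hlt) (h.pos_of_root_lt hx hp hlt).le).ne' hy
  · push Not at hroot
    -- In degree one the constant term has free sign and the root may be negative, but the
    -- derivative has no root. In higher degree p is positive on x > 0 while its constant term is
    -- nonpositive, so 0 is a root.
    cases m with
    | zero =>
      have hc := h.derivative
      obtain ⟨x, hx⟩ := exists_root_of_degree_eq_one
        (show p.degree = 1 from by
          exact_mod_cast (degree_eq_iff_natDegree_eq_of_pos one_pos).2 h.natDegree_eq)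
      refine ⟨x, hx, fun y hy => absurd hy ?_⟩
      rw [eq_C_of_natDegree_eq_zero hc.natDegree_eq]
      simpa using hc.lead_pos.ne'
    | succ m =>
      have hpos : ∀ x, 0 < x → 0 < p.eval x := by
        intro x hx
        by_contra! hle
        obtain ⟨y, hy, hxy⟩ := ((h.tendsto_atTop.eventually_gt_atTop 0).and
          (Filter.eventually_ge_atTop x)).exists
        obtain ⟨z, hz, hz0⟩ := intermediate_value_Icc hxy p.continuousOn ⟨hle, hy.le⟩
        exact hroot z (hx.trans_le hz.1) hz0
      have h0 : p.eval 0 = 0 := by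
        refine le_antisymm ?_ ?_
        · rw [← coeff_zero_eq_eval_zero]; exact h.coeff_nonpos 0 (by omega)
        · have ht : Filter.Tendsto (fun x => p.eval x) (nhdsWithin 0 (Set.Ioi 0))
              (nhds (p.eval 0)) := (p.continuous.tendsto 0).mono_left nhdsWithin_le_nhds
          exact ge_of_tendsto ht (Filter.eventually_of_mem self_mem_nhdsWithin
            fun x hx => (hpos x hx).le)
      refine ⟨0, h0, fun y hy => ?_⟩
      by_contra! hlt
      exact (h.derivative_pos hlt (hpos y hlt).le).ne' hy

theorem isRightNoetherian {m : ℕ} {p : ℝ[X]} (h : IsSignedPoly m p) : IsRightNoetherian p := by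
  intro k hk
  rw [h.natDegree_eq] at hk
  obtain ⟨d, rfl⟩ : ∃ d, m = d + 1 + k := ⟨m - (k + 1), by omega⟩
  have := (h.iterate_derivative k).exists_root_ge
  rwa [Function.iterate_succ_apply']

/-- For 0 < x < 1 the terms of index at most m sum to at most s x^m with s < 0, and after division
by x^m the top two terms vanish as x → 0. -/
theorem eval_neg_of_small {m : ℕ} {p : ℝ[X]} (h : IsSignedPoly (m + 2) p)
    (hneg : ∃ j ≤ m, p.coeff j < 0) : ∃ x, 0 < x ∧ p.eval x < 0 := by
  set s := ∑ j ∈ Finset.range (m + 1), p.coeff j with hs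
  have hs0 : s < 0 := by
    obtain ⟨j, hj, hlt⟩ := hneg
    exact Finset.sum_neg' (fun i hi => h.coeff_nonpos i (by simp at hi; omega))
      ⟨j, by simp; omega, hlt⟩
  have hcont : Filter.Tendsto (fun x : ℝ => s + p.coeff (m + 1) * x + p.coeff (m + 2) * x ^ 2)
      (nhdsWithin 0 (Set.Ioi 0)) (nhds s) := by
    have : Continuous (fun x : ℝ => s + p.coeff (m + 1) * x + p.coeff (m + 2) * x ^ 2) := by
      fun_prop
    have := (this.tendsto 0).mono_left (nhdsWithin_le_nhds (s := Set.Ioi 0))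
    simpa using this
  obtain ⟨x, hx, hx0, hx1⟩ := ((hcont.eventually_lt_const hs0).and
    (Ioo_mem_nhdsGT (zero_lt_one (α := ℝ)))).exists
  refine ⟨x, hx0, ?_⟩
  have h1 : p.eval x = ∑ i ∈ Finset.range (m + 3), p.coeff i * x ^ i :=
    eval_eq_sum_range' (by rw [h.natDegree_eq]; omega) x
  rw [h1, Finset.sum_range_succ, Finset.sum_range_succ]
  have h2 : ∑ i ∈ Finset.range (m + 1), p.coeff i * x ^ i ≤ s * x ^ m := by
    rw [hs, Finset.sum_mul]
    refine Finset.sum_le_sum fun i hi => ?_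
    have hi' : i ≤ m := by simp at hi; omega
    exact mul_le_mul_of_nonpos_left (pow_le_pow_of_le_one hx0.le hx1.le hi')
      (h.coeff_nonpos i (by omega))
  have h3 := mul_neg_of_neg_of_pos hx (pow_pos hx0 m)
  rw [pow_succ, pow_add]
  nlinarith

theorem exists_pos_root {m : ℕ} {p : ℝ[X]} (h : IsSignedPoly (m + 2) p)
    (hneg : ∃ j ≤ m, p.coeff j < 0) : ∃ x, 0 < x ∧ p.eval x = 0 := by
  obtain ⟨x, hx, hpx⟩ := h.eval_neg_of_small hneg
  obtain ⟨y, hy, hxy⟩ := ((IsSignedPoly.tendsto_atTop h).eventually_gt_atTop 0 |>.and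
    (Filter.eventually_ge_atTop x)).exists
  obtain ⟨z, hz, hz0⟩ := intermediate_value_Icc hxy p.continuousOn ⟨hpx.le, hy.le⟩
  exact ⟨z, hx.trans_le hz.1, hz0⟩

end IsSignedPoly

/-! ### The diagonal restriction of f -/

/-- The coefficients of the diagonal restriction. -/
theorem diagonalRestriction_guanZhangPoly (n : ℕ) (c : ℕ → ℝ) :
    diagonalRestriction (guanZhangPoly n c) = Polynomial.X ^ n
      + Polynomial.C (c (n - 1) * n.choose (n - 1)) * Polynomial.X ^ (n - 1)
      - ∑ k ∈ Finset.range (n - 1), Polynomial.C (c k * n.choose k) * Polynomial.X ^ k := by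
  have hes : ∀ k, MvPolynomial.aeval (fun _ => (Polynomial.X : Polynomial ℝ))
      (MvPolynomial.esymm (Fin n) ℝ k) = Polynomial.C (n.choose k : ℝ) * Polynomial.X ^ k := by
    intro k
    rw [MvPolynomial.esymm, map_sum]
    rw [Finset.sum_congr rfl (g := fun _ => Polynomial.X ^ k)]
    · simp
    · intro t ht
      rw [map_prod]
      simp [(Finset.mem_powersetCard.1 ht).2]
  have hC : ∀ a : ℝ, MvPolynomial.aeval (fun _ : Fin n => (Polynomial.X : Polynomial ℝ))
      (MvPolynomial.C a) = Polynomial.C a := fun a => by simp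
  simp only [diagonalRestriction, guanZhangPoly, map_add, map_sub, map_sum, map_mul, map_prod,
    hes, hC, MvPolynomial.aeval_X, Finset.prod_const, Finset.card_univ, Fintype.card_fin,
    mul_assoc]

theorem coeff_diagonalRestriction_guanZhangPoly (m : ℕ) (c : ℕ → ℝ) (j : ℕ) :
    (diagonalRestriction (guanZhangPoly (m + 2) c)).coeff j =
      (if j = m + 2 then 1 else 0) + (if j = m + 1 then c (m + 1) * (m + 2) else 0)
      - (if j < m + 1 then c j * (m + 2).choose j else 0) := by
  rw [diagonalRestriction_guanZhangPoly]
  rw [Polynomial.coeff_sub, Polynomial.coeff_add, Polynomial.finsetSum_coeff]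
  simp only [Polynomial.coeff_X_pow, Polynomial.coeff_C_mul, mul_ite, mul_one, mul_zero,
    Finset.sum_ite_eq, Finset.mem_range]
  simp
  norm_num [add_assoc]

theorem isSignedPoly_diagonalRestriction (m : ℕ) (c : ℕ → ℝ)
    (hc : ∀ k ∈ Finset.range (m + 1), 0 ≤ c k) :
    IsSignedPoly (m + 2) (diagonalRestriction (guanZhangPoly (m + 2) c)) where
  natDegree_eq := by
    apply Polynomial.natDegree_eq_of_le_of_coeff_ne_zero
    · rw [Polynomial.natDegree_le_iff_coeff_eq_zero]
      intro N hN
      rw [coeff_diagonalRestriction_guanZhangPoly, if_neg (by omega), if_neg (by omega),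
        if_neg (by omega)]
      norm_num
    · rw [coeff_diagonalRestriction_guanZhangPoly]; simp
  lead_pos := by rw [coeff_diagonalRestriction_guanZhangPoly]; simp
  coeff_nonpos j hj := by
    rw [coeff_diagonalRestriction_guanZhangPoly, if_neg (by omega), if_neg (by omega),
      if_pos (by omega)]
    have := mul_nonneg (hc j (by simp; omega)) (Nat.cast_nonneg (α := ℝ) ((m + 2).choose j))
    linarith

theorem exists_coeff_diagonalRestriction_neg (m : ℕ) (c : ℕ → ℝ)
    (hsum : 0 < ∑ k ∈ Finset.range (m + 1), c k) :
    ∃ j ≤ m, (diagonalRestriction (guanZhangPoly (m + 2) c)).coeff j < 0 := by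
  obtain ⟨j, hj, hpos⟩ := Finset.exists_lt_of_sum_lt (f := fun _ => (0 : ℝ)) (by simpa using hsum)
  have hj' : j < m + 1 := by simpa using hj
  refine ⟨j, by omega, ?_⟩
  rw [coeff_diagonalRestriction_guanZhangPoly, if_neg (by omega), if_neg (by omega), if_pos hj']
  have : (0 : ℝ) < (m + 2).choose j := by exact_mod_cast Nat.choose_pos (by omega)
  have := mul_pos hpos this
  linarith

/-! ### Concavity and monotonicity of quotients of the p_T -/

section

open Finset Function

variable {ι : Type*} [DecidableEq ι]

/-- Quotients p_U/p_V telescope along a chain from U to V that adds one index at a time. -/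
theorem Finset.superset_induction {p : Finset ι → Prop} (U : Finset ι) (base : p U)
    (step : ∀ (i : ι) (V : Finset ι), U ⊆ V → i ∉ V → p V → p (insert i V)) :
    ∀ V, U ⊆ V → p V := by
  intro V hV
  have key : ∀ W : Finset ι, Disjoint W U → p (W ∪ U) := by
    intro W
    induction W using Finset.induction_on with
    | empty => intro _; simpa using base
    | insert i W hi ih =>
      intro hd
      rw [Finset.disjoint_insert_left] at hd
      rw [Finset.insert_union]
      exact step i _ subset_union_right (by simp [hi, hd.1]) (ih hd.2)
  have := key (V \ U) sdiff_disjoint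
  rwa [Finset.sdiff_union_of_subset hV] at this

theorem Finset.nonempty_insert_induction {p : Finset ι → Prop} (base : ∀ i, p {i})
    (step : ∀ (i : ι) (V : Finset ι), V.Nonempty → i ∉ V → p V → p (insert i V)) :
    ∀ V, V.Nonempty → p V := by
  rintro V ⟨j, hj⟩
  exact Finset.superset_induction {j} (base j)
    (fun i V hV => step i V ⟨j, hV (mem_singleton_self j)⟩) V (by simpa using hj)

/-- The elementary symmetric polynomial of degree `#T - 1` in the variables indexed by `T`. -/
def penultimate (T : Finset ι) (x : ι → ℝ) : ℝ := ∑ i ∈ T, ∏ j ∈ T.erase i, x j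

/-- The quotient of the last two elementary symmetric polynomials in the variables of `T`. -/
noncomputable def parallelSum (T : Finset ι) (x : ι → ℝ) : ℝ := (∏ i ∈ T, x i) / penultimate T x

@[simp] theorem penultimate_singleton (i : ι) (x : ι → ℝ) : penultimate {i} x = 1 := by
  simp [penultimate]

@[simp] theorem parallelSum_singleton (i : ι) (x : ι → ℝ) : parallelSum {i} x = x i := by
  simp [parallelSum]

theorem penultimate_insert {i : ι} {T : Finset ι} (hi : i ∉ T) (x : ι → ℝ) :
    penultimate (insert i T) x = ∏ j ∈ T, x j + x i * penultimate T x := by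
  rw [penultimate, sum_insert hi, erase_insert hi, penultimate, mul_sum]
  congr 1
  refine sum_congr rfl fun j hj => ?_
  have hij : i ≠ j := fun h => hi (h ▸ hj)
  rw [erase_insert_of_ne hij, prod_insert (by simp [hi])]

/-- The factorization behind everything: positivity, monotonicity and log-concavity of p_V relative
to p_U are read off from the factors x_i + h_T. -/
theorem penultimate_insert_eq_mul {i : ι} {T : Finset ι} (hi : i ∉ T) {x : ι → ℝ}
    (hT : penultimate T x ≠ 0) :
    penultimate (insert i T) x = penultimate T x * (x i + parallelSum T x) := by
  rw [penultimate_insert hi, parallelSum]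
  field_simp
  ring

theorem parallelSum_insert {i : ι} {T : Finset ι} (hi : i ∉ T) {x : ι → ℝ}
    (hT : penultimate T x ≠ 0) :
    parallelSum (insert i T) x = x i * parallelSum T x / (x i + parallelSum T x) := by
  conv_lhs => rw [parallelSum, penultimate_insert_eq_mul hi hT, prod_insert hi]
  rw [← div_div]
  congr 1
  rw [parallelSum, mul_div_assoc]

theorem continuous_penultimate (T : Finset ι) : Continuous (penultimate T) := by
  unfold penultimate
  fun_prop

/-- The variational characterization of the parallel sum of two numbers. -/
theorem parallel_le {u v : ℝ} (h : 0 < u + v) (s : ℝ) :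
    u * v / (u + v) ≤ (1 - s) ^ 2 * u + s ^ 2 * v := by
  rw [div_le_iff₀ h]
  nlinarith [sq_nonneg ((u + v) * s - u)]

/-- The minimum in `parallel_le` is attained at s = u/(u+v). Only u + v > 0 is needed, so u or v may
be negative. -/
theorem parallel_eq {u v : ℝ} (h : 0 < u + v) :
    u * v / (u + v) = (1 - u / (u + v)) ^ 2 * u + (u / (u + v)) ^ 2 * v := by
  have := h.ne'
  field_simp
  ring

/-- The minimizing s for the larger pair is a test value for the smaller one, and its weights are
squares. -/
theorem parallel_mono {u v u' v' : ℝ} (h : 0 < u + v) (hu : u ≤ u') (hv : v ≤ v') :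
    u * v / (u + v) ≤ u' * v' / (u' + v') := by
  rw [parallel_eq (h.trans_le (add_le_add hu hv))]
  refine (parallel_le h (u' / (u' + v'))).trans ?_
  gcongr

variable (ι) in
/-- The set where all polynomials `penultimate T`, `T ≠ ∅`, are positive. -/
def penultimateCone : Set (ι → ℝ) := {x | ∀ T : Finset ι, T.Nonempty → 0 < penultimate T x}

theorem add_parallelSum_pos {x : ι → ℝ} (hx : x ∈ penultimateCone ι) {i : ι} {T : Finset ι}
    (hT : T.Nonempty) (hi : i ∉ T) : 0 < x i + parallelSum T x := by
  have h := hx (insert i T) (insert_nonempty i T)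
  rw [penultimate_insert_eq_mul hi (hx T hT).ne'] at h
  exact pos_of_mul_pos_right h (hx T hT).le

theorem mem_penultimateCone_of_pos {x : ι → ℝ} (hx : ∀ i, 0 < x i) : x ∈ penultimateCone ι :=
  fun _ hT => sum_pos (fun _ _ => prod_pos fun j _ => hx j) hT

theorem isOpen_penultimateCone [Fintype ι] : IsOpen (penultimateCone ι) := by
  have : penultimateCone ι = ⋂ T : {T : Finset ι // T.Nonempty}, {x | 0 < penultimate T.1 x} := by
    ext x; simp [penultimateCone]
  rw [this]
  exact isOpen_iInter_of_finite fun T =>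
    isOpen_lt continuous_const (continuous_penultimate T.1)

theorem parallelSum_insert_le {x : ι → ℝ} (hx : x ∈ penultimateCone ι) {i : ι} {T : Finset ι}
    (hT : T.Nonempty) (hi : i ∉ T) : parallelSum (insert i T) x ≤ parallelSum T x := by
  rw [parallelSum_insert hi (hx T hT).ne']
  -- At s = 1 the quadratic bound reduces to its second argument.
  simpa using parallel_le (add_parallelSum_pos hx hT hi) 1

theorem parallelSum_anti {x : ι → ℝ} (hx : x ∈ penultimateCone ι) {U V : Finset ι}
    (hU : U.Nonempty) (hUV : U ⊆ V) : parallelSum V x ≤ parallelSum U x :=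
  Finset.superset_induction (p := fun V => parallelSum V x ≤ parallelSum U x) U le_rfl
    (fun _ _ hV hi ih => (parallelSum_insert_le hx (hU.mono hV) hi).trans ih) V hUV

theorem parallelSum_le {x : ι → ℝ} (hx : x ∈ penultimateCone ι) {i : ι} {T : Finset ι}
    (hi : i ∈ T) : parallelSum T x ≤ x i := by
  simpa using parallelSum_anti hx (singleton_nonempty i) (singleton_subset_iff.2 hi)

/-- Both claims go through one induction: concavity of h_T keeps the next factor positive at z, and
this makes the recursion for h valid at z. The minimizing s at z then serves as test value at x and
y. -/
theorem penultimate_parallelSum_concave {x y : ι → ℝ} (hx : x ∈ penultimateCone ι)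
    (hy : y ∈ penultimateCone ι) {a b : ℝ} (ha : 0 ≤ a) (hb : 0 ≤ b) (hab : a + b = 1) :
    ∀ T : Finset ι, T.Nonempty → 0 < penultimate T (a • x + b • y) ∧
      a * parallelSum T x + b * parallelSum T y ≤ parallelSum T (a • x + b • y) := by
  set z := a • x + b • y with hz
  have hzi : ∀ i, z i = a * x i + b * y i := fun i => by simp [hz]
  refine Finset.nonempty_insert_induction (fun i => by simp [hzi]) ?_
  rintro i T hT hi ⟨hpos, hle⟩
  have hux := add_parallelSum_pos hx hT hi
  have huy := add_parallelSum_pos hy hT hi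
  have huz : 0 < z i + parallelSum T z := by
    rw [hzi]
    rcases ha.eq_or_lt with rfl | ha'
    · have : b = 1 := by linarith
      subst this; linarith
    · nlinarith [mul_pos ha' hux, mul_nonneg hb huy.le]
  refine ⟨by rw [penultimate_insert_eq_mul hi hpos.ne']; exact mul_pos hpos huz, ?_⟩
  rw [parallelSum_insert hi hpos.ne', parallelSum_insert hi (hx T hT).ne',
    parallelSum_insert hi (hy T hT).ne', parallel_eq huz]
  set s := z i / (z i + parallelSum T z)
  have h1 := mul_le_mul_of_nonneg_left (parallel_le hux s) ha
  have h2 := mul_le_mul_of_nonneg_left (parallel_le huy s) hb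
  have h3 := mul_le_mul_of_nonneg_left hle (sq_nonneg s)
  rw [hzi]
  nlinarith

theorem convex_penultimateCone : Convex ℝ (penultimateCone ι) :=
  fun _ hx _ hy _ _ ha hb hab T hT =>
    (penultimate_parallelSum_concave hx hy ha hb hab T hT).1

theorem concaveOn_parallelSum {T : Finset ι} (hT : T.Nonempty) :
    ConcaveOn ℝ (penultimateCone ι) (parallelSum T) :=
  ⟨convex_penultimateCone, fun _ hx _ hy _ _ ha hb hab =>
    (penultimate_parallelSum_concave hx hy ha hb hab T hT).2⟩

theorem penultimate_parallelSum_mono {x y : ι → ℝ} (hx : x ∈ penultimateCone ι) (hxy : x ≤ y) :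
    ∀ T : Finset ι, T.Nonempty → 0 < penultimate T y ∧ parallelSum T x ≤ parallelSum T y := by
  refine Finset.nonempty_insert_induction (fun i => by simpa using hxy i) ?_
  rintro i T hT hi ⟨hpos, hle⟩
  have hux := add_parallelSum_pos hx hT hi
  have huy : 0 < y i + parallelSum T y := hux.trans_le (add_le_add (hxy i) hle)
  refine ⟨by rw [penultimate_insert_eq_mul hi hpos.ne']; exact mul_pos hpos huy, ?_⟩
  rw [parallelSum_insert hi hpos.ne', parallelSum_insert hi (hx T hT).ne']
  exact parallel_mono hux (hxy i) hle

theorem isUpperSet_penultimateCone : IsUpperSet (penultimateCone ι) :=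
  fun _ _ hxy hx T hT => (penultimate_parallelSum_mono hx hxy T hT).1

theorem monotoneOn_parallelSum {T : Finset ι} (hT : T.Nonempty) :
    MonotoneOn (parallelSum T) (penultimateCone ι) :=
  fun _ hx _ _ hxy => (penultimate_parallelSum_mono hx hxy T hT).2

theorem ConcaveOn.log_of_pos {E : Type*} [AddCommGroup E] [Module ℝ E] {s : Set E} {φ : E → ℝ}
    (h : ConcaveOn ℝ s φ) (hpos : ∀ x ∈ s, 0 < φ x) : ConcaveOn ℝ s fun x => Real.log (φ x) := by
  refine ⟨h.1, fun x hx y hy a b ha hb hab => ?_⟩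
  have hlog := strictConcaveOn_log_Ioi.concaveOn.2 (hpos x hx) (hpos y hy) ha hb hab
  refine hlog.trans (Real.log_le_log ?_ (h.2 hx hy ha hb hab))
  exact (convex_Ioi (0 : ℝ)) (hpos x hx) (hpos y hy) ha hb hab

/-- The difference telescopes into a sum of logarithms of the positive concave factors x_i + h_T. -/
theorem concaveOn_log_penultimate_sub {U V : Finset ι} (hU : U.Nonempty) (hUV : U ⊆ V) :
    ConcaveOn ℝ (penultimateCone ι)
      fun x => Real.log (penultimate V x) - Real.log (penultimate U x) := by
  revert hUV
  refine Finset.superset_induction (p := fun V => ConcaveOn ℝ (penultimateCone ι)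
      fun x => Real.log (penultimate V x) - Real.log (penultimate U x)) U ?_ ?_ V
  · simpa using concaveOn_const (0 : ℝ) convex_penultimateCone
  · intro i V hV hi ih
    have hVn := hU.mono hV
    have hlin : ConcaveOn ℝ (penultimateCone ι) fun x : ι → ℝ => x i :=
      (LinearMap.proj (R := ℝ) (φ := fun _ : ι => ℝ) i).concaveOn convex_penultimateCone
    refine (ih.add ((hlin.add (concaveOn_parallelSum hVn)).log_of_pos
      fun x hx => add_parallelSum_pos hx hVn hi)).congr fun x hx => ?_
    simp only [Pi.add_apply]
    rw [penultimate_insert_eq_mul hi (hx V hVn).ne',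
      Real.log_mul (hx V hVn).ne' (add_parallelSum_pos hx hVn hi).ne']
    ring

theorem convexOn_penultimate_div {U V : Finset ι} (hUV : U ⊆ V) :
    ConvexOn ℝ (penultimateCone ι) fun x => penultimate U x / penultimate V x := by
  rcases U.eq_empty_or_nonempty with rfl | hU
  · simpa [penultimate] using convexOn_const (0 : ℝ) convex_penultimateCone
  · have h := (concaveOn_log_penultimate_sub hU hUV).neg
    refine ⟨convex_penultimateCone, fun x hx y hy a b ha hb hab => ?_⟩
    have hexp : ∀ w ∈ penultimateCone ι, penultimate U w / penultimate V w =
        Real.exp (-(Real.log (penultimate V w) - Real.log (penultimate U w))) := by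
      intro w hw
      rw [neg_sub, Real.exp_sub, Real.exp_log (hw U hU), Real.exp_log (hw V (hU.mono hUV))]
    simp only
    rw [hexp x hx, hexp y hy, hexp _ (convex_penultimateCone hx hy ha hb hab)]
    refine le_trans (Real.exp_le_exp.2 (h.2 hx hy ha hb hab)) ?_
    exact convexOn_exp.2 (Set.mem_univ _) (Set.mem_univ _) ha hb hab

theorem antitoneOn_penultimate_div {U V : Finset ι} (hUV : U ⊆ V) :
    AntitoneOn (fun x => penultimate U x / penultimate V x) (penultimateCone ι) := by
  rcases U.eq_empty_or_nonempty with rfl | hU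
  · intro x _ y _ _; simp [penultimate]
  revert hUV
  refine Finset.superset_induction (p := fun V =>
    AntitoneOn (fun x => penultimate U x / penultimate V x) (penultimateCone ι)) U ?_ ?_ V
  · intro x hx y hy _
    simp only
    rw [div_self (hx U hU).ne', div_self (hy U hU).ne']
  · intro i V hV hi ih x hx y hy hxy
    have hVn := hU.mono hV
    simp only
    rw [penultimate_insert_eq_mul hi (hx V hVn).ne', penultimate_insert_eq_mul hi (hy V hVn).ne',
      ← div_div, ← div_div]
    have h1 := add_parallelSum_pos hx hVn hi
    have h2 : x i + parallelSum V x ≤ y i + parallelSum V y :=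
      add_le_add (hxy i) (monotoneOn_parallelSum hVn hx hy hxy)
    exact div_le_div₀ (div_nonneg (hx U hU).le (hx V hVn).le) (ih hx hy hxy) h1 h2

/-- Inserting i last isolates the factor x_i + h of the other variables, which increases strictly
with x_i. -/
theorem penultimate_div_lt [Fintype ι] {U : Finset ι} (hU : U.Nonempty) {i : ι} (hi : i ∉ U)
    {x y : ι → ℝ} (hx : x ∈ penultimateCone ι) (hxy : x ≤ y) (hlt : x i < y i) :
    penultimate U y / penultimate univ y < penultimate U x / penultimate univ x := by
  have hy := isUpperSet_penultimateCone hxy hx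
  have hsub : U ⊆ univ.erase i := fun j hj => by
    simp only [mem_erase, mem_univ, and_true]; rintro rfl; exact hi hj
  have hVn := hU.mono hsub
  have huniv : (univ : Finset ι) = insert i (univ.erase i) := (insert_erase (mem_univ i)).symm
  have hni : i ∉ (univ : Finset ι).erase i := notMem_erase i _
  rw [huniv, penultimate_insert_eq_mul hni (hx _ hVn).ne',
    penultimate_insert_eq_mul hni (hy _ hVn).ne', ← div_div, ← div_div]
  have h1 := add_parallelSum_pos hx hVn hni
  have h2 := add_lt_add_of_lt_of_le hlt (monotoneOn_parallelSum hVn hx hy hxy)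
  exact div_lt_div₀' (antitoneOn_penultimate_div hsub hx hy hxy) h2
    (div_pos (hx U hU) (hx _ hVn)) h1

theorem penultimate_nonneg {x : ι → ℝ} (hx : x ∈ penultimateCone ι) (U : Finset ι) :
    0 ≤ penultimate U x := by
  rcases U.eq_empty_or_nonempty with rfl | hU
  · simp [penultimate]
  · exact (hx U hU).le

/-- On a bounded set each factor x_i + h_V is bounded above, since h_V ≤ x_j for any j in V. -/
theorem exists_penultimate_le_mul (R : ℝ) {U V : Finset ι} (hU : U.Nonempty) (hUV : U ⊆ V) :
    ∃ K > 0, ∀ x ∈ penultimateCone ι, (∀ i, |x i| ≤ R) → penultimate V x ≤ K * penultimate U x := by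
  revert hUV
  refine Finset.superset_induction (p := fun V => ∃ K > 0, ∀ x ∈ penultimateCone ι,
    (∀ i, |x i| ≤ R) → penultimate V x ≤ K * penultimate U x) U ⟨1, one_pos, by simp⟩ ?_ V
  rintro i V hV hi ⟨K, hK, h⟩
  refine ⟨K * (2 * |R| + 1), by positivity, fun x hx hR => ?_⟩
  have hVn := hU.mono hV
  obtain ⟨j, hj⟩ := id hVn
  rw [penultimate_insert_eq_mul hi (hx V hVn).ne']
  have h1 : x i + parallelSum V x ≤ 2 * |R| + 1 := by
    have := parallelSum_le hx hj
    have := le_abs_self (x i)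
    have := le_abs_self (x j)
    have := hR i
    have := hR j
    have := le_abs_self R
    linarith
  calc _ ≤ (K * penultimate U x) * (2 * |R| + 1) :=
        mul_le_mul (h x hx hR) h1 (add_parallelSum_pos hx hVn hi).le
          (mul_nonneg hK.le (hx U hU).le)
    _ = _ := by ring

end

/-! ### The region f > 0 inside the cone, and its frontier -/

section

open Finset Function Set Filter Topology

variable {ι : Type*} [DecidableEq ι] [Fintype ι]

/-- The polynomials under study: the product of all
variables, plus a multiple of `penultimate univ`, minus a nonnegative combination of the
polynomials `penultimate U`. -/
def penultimateComb (c : ℝ) (a : Finset ι → ℝ) (x : ι → ℝ) : ℝ :=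
  ∏ i, x i + c * penultimate univ x - ∑ U, a U * penultimate U x

/-- The part of the positivity set of `penultimateComb c a` in the cone `penultimateCone ι`. -/
def positiveRegion (c : ℝ) (a : Finset ι → ℝ) : Set (ι → ℝ) :=
  {x | x ∈ penultimateCone ι ∧ 0 < penultimateComb c a x}

/-- The quotient of `penultimateComb c a` by `penultimate univ`. -/
noncomputable def combQuotient (c : ℝ) (a : Finset ι → ℝ) (x : ι → ℝ) : ℝ :=
  parallelSum univ x + c - ∑ U, a U * (penultimate U x / penultimate univ x)

variable {c : ℝ} {a : Finset ι → ℝ}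

theorem continuous_penultimateComb : Continuous (penultimateComb c a) := by
  unfold penultimateComb
  have := fun T : Finset ι => continuous_penultimate T
  fun_prop

theorem isOpen_positiveRegion : IsOpen (positiveRegion c a) :=
  isOpen_penultimateCone.inter (isOpen_lt continuous_const continuous_penultimateComb)

theorem penultimate_univ_pos [Nonempty ι] {x : ι → ℝ} (hx : x ∈ penultimateCone ι) :
    0 < penultimate univ x := hx univ univ_nonempty

theorem penultimateComb_eq_mul [Nonempty ι] {x : ι → ℝ} (hx : x ∈ penultimateCone ι) :
    penultimateComb c a x = penultimate univ x * combQuotient c a x := by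
  have h := (penultimate_univ_pos hx).ne'
  rw [penultimateComb, combQuotient, parallelSum, mul_sub, mul_add, mul_div_cancel₀ _ h, mul_sum,
    mul_comm c]
  congr 1
  refine Finset.sum_congr rfl fun U _ => ?_
  field_simp

theorem concaveOn_combQuotient [Nonempty ι] (ha : ∀ U, 0 ≤ a U) :
    ConcaveOn ℝ (penultimateCone ι) (combQuotient c a) := by
  have h1 := (concaveOn_parallelSum (ι := ι) univ_nonempty).add
    (concaveOn_const c convex_penultimateCone)
  refine h1.sub ?_
  refine ⟨convex_penultimateCone, fun x hx y hy s t hs ht hst => ?_⟩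
  simp only [smul_eq_mul, mul_sum]
  rw [← sum_add_distrib]
  refine Finset.sum_le_sum fun U _ => ?_
  have := mul_le_mul_of_nonneg_left
    ((convexOn_penultimate_div (Finset.subset_univ U)).2 hx hy hs ht hst) (ha U)
  simp only [smul_eq_mul] at this
  linarith

theorem mem_positiveRegion_iff [Nonempty ι] {x : ι → ℝ} :
    x ∈ positiveRegion c a ↔ x ∈ penultimateCone ι ∧ 0 < combQuotient c a x := by
  refine and_congr_right fun hx => ?_
  rw [penultimateComb_eq_mul hx, mul_pos_iff_of_pos_left (penultimate_univ_pos hx)]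

theorem convex_positiveRegion [Nonempty ι] (ha : ∀ U, 0 ≤ a U) :
    Convex ℝ (positiveRegion c a) := by
  have h : positiveRegion c a = {x ∈ penultimateCone ι | 0 < combQuotient c a x} :=
    Set.ext fun _ => mem_positiveRegion_iff
  exact h ▸ (concaveOn_combQuotient ha).convex_gt 0

theorem combQuotient_lt [Nonempty ι] (ha : ∀ U, 0 ≤ a U)
    (hex : ∀ i, ∃ U : Finset ι, U.Nonempty ∧ i ∉ U ∧ 0 < a U) {x y : ι → ℝ}
    (hx : x ∈ penultimateCone ι) (hxy : x < y) : combQuotient c a x < combQuotient c a y := by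
  obtain ⟨hle, i, hi⟩ := Pi.lt_def.1 hxy
  have hy := isUpperSet_penultimateCone hle hx
  obtain ⟨U, hU, hiU, haU⟩ := hex i
  have h1 := monotoneOn_parallelSum univ_nonempty hx hy hle
  suffices h2 : ∑ V, a V * (penultimate V y / penultimate univ y)
      < ∑ V, a V * (penultimate V x / penultimate univ x) by
    unfold combQuotient
    linarith
  refine Finset.sum_lt_sum (fun V _ => mul_le_mul_of_nonneg_left
    (antitoneOn_penultimate_div (Finset.subset_univ V) hx hy hle) (ha V))
    ⟨U, Finset.mem_univ U, mul_lt_mul_of_pos_left (penultimate_div_lt hU hiU hx hle hi) haU⟩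

theorem mem_positiveRegion_of_lt [Nonempty ι] (ha : ∀ U, 0 ≤ a U)
    (hex : ∀ i, ∃ U : Finset ι, U.Nonempty ∧ i ∉ U ∧ 0 < a U) {x y : ι → ℝ}
    (hx : x ∈ penultimateCone ι) (h0 : 0 ≤ penultimateComb c a x) (hxy : x < y) :
    y ∈ positiveRegion c a := by
  rw [penultimateComb_eq_mul hx, mul_nonneg_iff_of_pos_left (penultimate_univ_pos hx)] at h0
  exact mem_positiveRegion_iff.2
    ⟨isUpperSet_penultimateCone hxy.le hx, h0.trans_lt (combQuotient_lt ha hex hx hxy)⟩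

theorem isUpperSet_positiveRegion [Nonempty ι] (ha : ∀ U, 0 ≤ a U)
    (hex : ∀ i, ∃ U : Finset ι, U.Nonempty ∧ i ∉ U ∧ 0 < a U) :
    IsUpperSet (positiveRegion c a) := by
  intro x y hxy hx
  rcases hxy.eq_or_lt with rfl | hlt
  · exact hx
  · exact mem_positiveRegion_of_lt ha hex hx.1 hx.2.le hlt

/-- In f/p_univ > 0 all subtracted terms are nonnegative, so each is below h_univ + c ≤ x_i + c. -/
theorem mul_penultimate_div_lt [Nonempty ι] (ha : ∀ U, 0 ≤ a U) {x : ι → ℝ}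
    (hx : x ∈ positiveRegion c a) (i : ι) (U : Finset ι) :
    a U * (penultimate U x / penultimate univ x) < x i + c := by
  obtain ⟨hxD, hq⟩ := mem_positiveRegion_iff.1 hx
  have h1 : a U * (penultimate U x / penultimate univ x)
      ≤ ∑ U, a U * (penultimate U x / penultimate univ x) :=
    Finset.single_le_sum (f := fun U => a U * (penultimate U x / penultimate univ x))
      (fun V _ => mul_nonneg (ha V) (div_nonneg (penultimate_nonneg hxD V)
        (penultimate_nonneg hxD _))) (Finset.mem_univ U)
  have h2 := parallelSum_le hxD (Finset.mem_univ i)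
  rw [combQuotient] at hq
  linarith

theorem neg_lt_of_mem_positiveRegion [Nonempty ι] (ha : ∀ U, 0 ≤ a U) {x : ι → ℝ}
    (hx : x ∈ positiveRegion c a) (i : ι) : -c < x i := by
  -- `penultimate ∅` is an empty sum, so the left side is 0.
  have := mul_penultimate_div_lt ha hx i ∅
  simp [penultimate] at this
  linarith

/-- Take U avoiding i with a_U > 0, and let w = x_i + h over the other variables. Then p_univ is p
over those variables times w, hence at most K p_U w, so a_U/(K w) ≤ a_U p_U/p_univ < x_i + c, which
is bounded: w cannot approach 0. Smaller T only enlarge h_T. -/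
theorem exists_le_add_parallelSum [Nonempty ι] (ha : ∀ U, 0 ≤ a U)
    (hex : ∀ i, ∃ U : Finset ι, U.Nonempty ∧ i ∉ U ∧ 0 < a U) (R : ℝ) (i : ι) :
    ∃ ε > 0, ∀ x ∈ positiveRegion c a, (∀ i, |x i| ≤ R) → ∀ T : Finset ι, T.Nonempty → i ∉ T →
      ε ≤ x i + parallelSum T x := by
  obtain ⟨U, hU, hiU, haU⟩ := hex i
  have hsub : ∀ {T : Finset ι}, i ∉ T → T ⊆ univ.erase i := fun {T} hT j hj => by
    simp only [Finset.mem_erase, Finset.mem_univ, and_true]; rintro rfl; exact hT hj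
  have hVn := hU.mono (hsub hiU)
  obtain ⟨K, hK, hle⟩ := exists_penultimate_le_mul R hU (hsub hiU)
  refine ⟨a U / ((|R| + |c| + 1) * K), by positivity, fun x hx hR T hT hiT => ?_⟩
  refine le_trans ?_ (add_le_add_right (parallelSum_anti hx.1 hT (hsub hiT)) (x i))
  have h1 := mul_penultimate_div_lt ha hx i U
  have hni : i ∉ (univ : Finset ι).erase i := Finset.notMem_erase i _
  have hsplit : penultimate univ x =
      penultimate (univ.erase i) x * (x i + parallelSum (univ.erase i) x) := by
    rw [← penultimate_insert_eq_mul hni (hx.1 _ hVn).ne', Finset.insert_erase (Finset.mem_univ i)]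
  have h2 : x i + c ≤ |R| + |c| + 1 := by
    have := le_abs_self (x i)
    have := hR i
    have := le_abs_self R
    have := le_abs_self c
    linarith
  have hw := add_parallelSum_pos hx.1 hVn hni
  set w := x i + parallelSum (univ.erase i) x
  have hUpos := hx.1 U hU
  have hu := penultimate_univ_pos hx.1
  rw [← mul_div_assoc, div_lt_iff₀ hu] at h1
  rw [div_le_iff₀ (by positivity)]
  have h3 : a U * penultimate U x ≤ (|R| + |c| + 1) * ((K * penultimate U x) * w) := by
    refine h1.le.trans (mul_le_mul h2 ?_ hu.le (by positivity))
    rw [hsplit]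
    exact mul_le_mul_of_nonneg_right (hle x hx.1 hR) hw.le
  refine le_of_mul_le_mul_right (h3.trans_eq ?_) hUpos
  ring

theorem exists_le_penultimate [Nonempty ι] (ha : ∀ U, 0 ≤ a U)
    (hex : ∀ i, ∃ U : Finset ι, U.Nonempty ∧ i ∉ U ∧ 0 < a U) (R : ℝ) :
    ∀ T : Finset ι, T.Nonempty →
      ∃ δ > 0, ∀ x ∈ positiveRegion c a, (∀ i, |x i| ≤ R) → δ ≤ penultimate T x := by
  refine Finset.nonempty_insert_induction (fun i => ⟨1, one_pos, by simp⟩) ?_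
  rintro i T hT hi ⟨δ, hδ, h⟩
  obtain ⟨ε, hε, h'⟩ := exists_le_add_parallelSum (c := c) ha hex R i
  refine ⟨δ * ε, mul_pos hδ hε, fun x hx hR => ?_⟩
  rw [penultimate_insert_eq_mul hi (hx.1 T hT).ne']
  exact mul_le_mul (h x hx hR) (h' x hx hR T hT hi) hε.le (hx.1 T hT).le

theorem closure_positiveRegion_subset [Nonempty ι] (ha : ∀ U, 0 ≤ a U)
    (hex : ∀ i, ∃ U : Finset ι, U.Nonempty ∧ i ∉ U ∧ 0 < a U) :
    closure (positiveRegion c a) ⊆ penultimateCone ι := by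
  intro x hx T hT
  -- The radius covers the unit ball around x, where the uniform bound passes to the limit.
  obtain ⟨δ, hδ, h⟩ := exists_le_penultimate (c := c) ha hex (‖x‖ + 1) T hT
  refine hδ.trans_le ?_
  have hx' : x ∈ closure (positiveRegion c a ∩ Metric.ball x 1) :=
    closure_mono (inter_comm _ _).subset (Metric.isOpen_ball.inter_closure
      ⟨Metric.mem_ball_self one_pos, hx⟩)
  refine closure_minimal (t := {y | δ ≤ penultimate T y}) ?_
    (isClosed_le continuous_const (continuous_penultimate T)) hx'
  rintro y ⟨hy, hyb⟩
  refine h y hy fun i => ?_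
  have h1 : ‖y i‖ ≤ ‖y‖ := norm_le_pi_norm y i
  have h2 : ‖y‖ ≤ ‖x‖ + ‖y - x‖ := norm_le_norm_add_norm_sub' y x
  rw [Metric.mem_ball, dist_eq_norm] at hyb
  rw [← Real.norm_eq_abs]
  linarith

theorem frontier_positiveRegion [Nonempty ι] (ha : ∀ U, 0 ≤ a U)
    (hex : ∀ i, ∃ U : Finset ι, U.Nonempty ∧ i ∉ U ∧ 0 < a U) :
    frontier (positiveRegion c a) = {x | x ∈ penultimateCone ι ∧ penultimateComb c a x = 0} := by
  rw [isOpen_positiveRegion.frontier_eq]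
  ext x
  constructor
  · rintro ⟨hx, hnx⟩
    have hD := closure_positiveRegion_subset ha hex hx
    refine ⟨hD, le_antisymm (not_lt.1 fun h => hnx ⟨hD, h⟩) ?_⟩
    exact closure_minimal (t := {y | 0 ≤ penultimateComb c a y}) (fun y hy => hy.2.le)
      (isClosed_le continuous_const continuous_penultimateComb) hx
  · rintro ⟨hD, h0⟩
    refine ⟨?_, fun h => h.2.ne' h0⟩
    -- A zero in the cone is a limit of points of the region, by strict increase along the diagonal.
    have ht : Tendsto (fun t : ℝ => x + fun _ => t) (𝓝[>] 0) (𝓝 x) := by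
      have : Continuous (fun t : ℝ => x + fun _ : ι => t) := by fun_prop
      have := (this.tendsto 0).mono_left (nhdsWithin_le_nhds (s := Set.Ioi 0))
      convert this using 2
      ext i; simp
    refine mem_closure_of_tendsto ht (eventually_of_mem self_mem_nhdsWithin fun t ht => ?_)
    have ht' : (0 : ℝ) < t := ht
    refine mem_positiveRegion_of_lt ha hex hD h0.ge (Pi.lt_def.2 ⟨fun i => ?_, ?_⟩)
    · simp [ht'.le]
    · exact ⟨Classical.arbitrary ι, by simpa using ht'⟩

/-- The boundary of a nonempty open upper set that is bounded below is connected. -/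
theorem IsUpperSet.isPreconnected_frontier {κ : Type*} [Fintype κ] [Nonempty κ]
    {s : Set (κ → ℝ)} (hs : IsUpperSet s) (ho : IsOpen s) (hne : s.Nonempty) (hb : BddBelow s) : IsPreconnected (frontier s) := by
  obtain ⟨z, hz⟩ := hne
  obtain ⟨q, hq⟩ := hb
  let e : κ → ℝ := fun _ => 1
  let A : (κ → ℝ) → Set ℝ := fun x => {t | x + t • e ∈ s}
  have hAne : ∀ x, (A x).Nonempty := fun x => by
    refine ⟨‖z - x‖, hs (fun i => ?_) hz⟩
    have : |z i - x i| ≤ ‖z - x‖ := norm_le_pi_norm (z - x) i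
    have := le_abs_self (z i - x i)
    simp [e]; linarith
  have hAb : ∀ x, BddBelow (A x) := fun x => by
    let i := Classical.arbitrary κ
    refine ⟨q i - x i, fun t ht => ?_⟩
    have := hq ht i
    simp [e] at this; linarith
  -- The entry time into `s` along the diagonal is 1-Lipschitz for the sup norm, so x ↦ x + τ(x) e
  -- maps the connected space continuously onto the frontier.
  let τ : (κ → ℝ) → ℝ := fun x => sInf (A x)
  have hlip : ∀ x y, τ y ≤ τ x + dist x y := by
    intro x y
    rw [← sub_le_iff_le_add]
    refine le_csInf (hAne x) fun t ht => ?_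
    rw [sub_le_iff_le_add]
    refine csInf_le (hAb y) (hs (fun i => ?_) ht)
    have h1 : dist (x i) (y i) ≤ dist x y := dist_le_pi_dist x y i
    rw [Real.dist_eq] at h1
    have := le_abs_self (x i - y i)
    simp [e]; linarith
  have hτ : Continuous τ := by
    have : LipschitzWith 1 τ := LipschitzWith.of_le_add fun x y => by
      rw [dist_comm]; exact hlip y x
    exact this.continuous
  have hrange : frontier s = Set.range fun x => x + τ x • e := by
    rw [ho.frontier_eq]
    ext x
    constructor
    · rintro ⟨hx, hnx⟩
      refine ⟨x, ?_⟩
      suffices τ x = 0 by simp [this]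
      refine le_antisymm (le_of_forall_pos_le_add fun ε hε => ?_) ?_
      · obtain ⟨y, hy, hd⟩ := Metric.mem_closure_iff.1 hx ε hε
        refine csInf_le (hAb x) (hs (fun i => ?_) hy)
        have h1 : dist (x i) (y i) ≤ dist x y := dist_le_pi_dist x y i
        rw [Real.dist_eq] at h1
        have := neg_abs_le (x i - y i)
        simp [e]; linarith
      · refine le_csInf (hAne x) fun t ht => ?_
        by_contra! hlt
        refine hnx (hs (fun i => ?_) ht)
        simp [e]; exact hlt.le
    · rintro ⟨y, rfl⟩
      have hcl : τ y ∈ closure (A y) := csInf_mem_closure (hAne y) (hAb y)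
      have hcont : Continuous fun t : ℝ => y + t • e := by fun_prop
      refine ⟨?_, fun hmem => ?_⟩
      · exact map_mem_closure (f := fun t : ℝ => y + t • e) hcont hcl fun t ht => ht
      · have hop : IsOpen (A y) := ho.preimage hcont
        obtain ⟨ε, hε, hball⟩ := Metric.isOpen_iff.1 hop (τ y) hmem
        have : τ y - ε / 2 ∈ A y := hball (by
          rw [Metric.mem_ball, Real.dist_eq, sub_sub_cancel_left, abs_neg, abs_of_pos (half_pos hε)]
          linarith)
        have := csInf_le (hAb y) this
        have : τ y ≤ τ y - ε / 2 := this
        linarith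
  rw [hrange]
  exact isPreconnected_range (by fun_prop)

end

/-! ### Multiaffine functions: components bounded below -/

section

open Finset Function Set Filter Topology

variable {ι : Type*} [DecidableEq ι]

/-- `F` is an affine function of each variable. -/
def IsMultiaffine (F : (ι → ℝ) → ℝ) : Prop :=
  ∀ x i t, F (update x i t) = (1 - t) * F (update x i 0) + t * F (update x i 1)

/-- The slope of a multiaffine function in the `i`-th variable. -/
def slopeAt (F : (ι → ℝ) → ℝ) (i : ι) (x : ι → ℝ) : ℝ := F (update x i 1) - F (update x i 0)

namespace IsMultiaffine

variable {F G : (ι → ℝ) → ℝ}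

theorem const_mul (hF : IsMultiaffine F) (r : ℝ) : IsMultiaffine fun x => r * F x := by
  intro x i t; simp only; rw [hF x i t]; ring

theorem add (hF : IsMultiaffine F) (hG : IsMultiaffine G) : IsMultiaffine fun x => F x + G x := by
  intro x i t; simp only; rw [hF x i t, hG x i t]; ring

theorem sum {κ : Type*} {s : Finset κ} {H : κ → (ι → ℝ) → ℝ} (h : ∀ k ∈ s, IsMultiaffine (H k)) :
    IsMultiaffine fun x => ∑ k ∈ s, H k x := by
  intro x i t
  simp only [mul_sum]
  rw [← sum_add_distrib]
  exact Finset.sum_congr rfl fun k hk => h k hk x i t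

theorem prod (T : Finset ι) : IsMultiaffine fun x => ∏ i ∈ T, x i := by
  intro x i t
  by_cases hi : i ∈ T
  · simp only [prod_update_of_mem hi]; ring
  · simp only [prod_update_of_notMem hi]; ring

theorem update_eq (hF : IsMultiaffine F) (x : ι → ℝ) (i : ι) (t : ℝ) :
    F (update x i t) = F x + (t - x i) * slopeAt F i x := by
  have h := hF x i (x i)
  rw [update_eq_self] at h
  rw [hF x i t, h, slopeAt]
  ring

/-- The mixed second difference of a multiaffine function, along a coordinate plane. -/
theorem slopeAt_update (hF : IsMultiaffine F) (x : ι → ℝ) {i j : ι} (hij : i ≠ j) (s : ℝ) :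
    slopeAt F j (update x i s) = slopeAt F j x + (s - x i) * slopeAt (slopeAt F j) i x := by
  have h1 := hF.update_eq (update x j 1) i s
  have h0 := hF.update_eq (update x j 0) i s
  rw [update_of_ne hij, update_comm hij.symm] at h1 h0
  simp only [slopeAt] at h1 h0 ⊢
  rw [h1, h0, update_comm hij.symm 1 1, update_comm hij.symm 1 0, update_comm hij.symm 0 1,
    update_comm hij.symm 0 0]
  ring

end IsMultiaffine

theorem slopeAt_comm (F : (ι → ℝ) → ℝ) (x : ι → ℝ) {i j : ι} (hij : i ≠ j) :
    slopeAt (slopeAt F j) i x = slopeAt (slopeAt F i) j x := by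
  simp only [slopeAt]
  rw [update_comm hij 1 1, update_comm hij 1 0, update_comm hij 0 1, update_comm hij 0 0]
  ring

theorem slopeAt_update_self (F : (ι → ℝ) → ℝ) (i : ι) (x : ι → ℝ) (t : ℝ) :
    slopeAt F i (update x i t) = slopeAt F i x := by
  simp [slopeAt]

theorem isMultiaffine_penultimate (T : Finset ι) : IsMultiaffine (penultimate T) :=
  IsMultiaffine.sum fun i _ => IsMultiaffine.prod (T.erase i)

theorem isMultiaffine_penultimateComb [Fintype ι] (c : ℝ) (a : Finset ι → ℝ) :
    IsMultiaffine (penultimateComb c a) := by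
  have h := ((IsMultiaffine.prod (univ : Finset ι)).add
    ((isMultiaffine_penultimate univ).const_mul c)).add
      ((IsMultiaffine.sum (s := univ) fun U _ =>
        (isMultiaffine_penultimate U).const_mul (a U)).const_mul (-1))
  intro x i t
  have := h x i t
  simp only [penultimateComb]
  linarith

/-- A connected component of `S` absorbs the preconnected subsets of `S` that meet it. -/
theorem subset_of_eq_connectedComponentIn {X : Type*} [TopologicalSpace X] {S C A : Set X} {x : X}
    (hC : C = connectedComponentIn S x) (hA : IsPreconnected A) (hAS : A ⊆ S)
    (hAC : (A ∩ C).Nonempty) : A ⊆ C := by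
  obtain ⟨y, hyA, hyC⟩ := hAC
  rw [hC] at hyC ⊢
  rw [connectedComponentIn_eq hyC]
  exact hA.subset_connectedComponentIn hyA hAS

theorem component_subset {X : Type*} [TopologicalSpace X] {S C : Set X} {x : X}
    (hC : C = connectedComponentIn S x) : C ⊆ S :=
  hC ▸ connectedComponentIn_subset S x

/-- If `update` along a set of coordinates preserves `C`, then so does moving to any upper bound. -/
theorem isUpperSet_of_update_mem [Fintype ι] {C : Set (ι → ℝ)}
    (h : ∀ x ∈ C, ∀ i t, x i ≤ t → update x i t ∈ C) : IsUpperSet C := by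
  intro x z hxz hx
  have key : ∀ T : Finset ι, T.piecewise z x ∈ C := by
    intro T
    induction T using Finset.induction_on with
    | empty => simpa using hx
    | insert i T hi ih =>
      rw [Finset.piecewise_insert]
      exact h _ ih i (z i) (by simpa [hi] using hxz i)
  simpa using key univ

theorem mul_nonneg_of_mem_uIcc {r s t k : ℝ} (ht : 0 ≤ (t - r) * k) (hs : s ∈ Set.uIcc r t) :
    0 ≤ (s - r) * k := by
  rcases Set.mem_uIcc.1 hs with ⟨h1, h2⟩ | ⟨h1, h2⟩
  · rcases h1.eq_or_lt with rfl | h1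
    · simp
    · exact mul_nonneg (by linarith) (nonneg_of_mul_nonneg_right ht (by linarith))
  · rcases h2.eq_or_lt with rfl | h2
    · simp
    · exact mul_nonneg_of_nonpos_of_nonpos (by linarith) (by by_contra! hs; nlinarith)

section Components

variable {F : (ι → ℝ) → ℝ}

/-- A negative slope would let a coordinate decrease without bound while F stays positive. So slopes
are nonnegative and increasing a coordinate keeps F positive. -/
theorem isUpperSet_positive_component [Fintype ι] (hF : IsMultiaffine F) {C : Set (ι → ℝ)}
    {x : ι → ℝ}
    (hC : C = connectedComponentIn {y | 0 < F y} x) (hb : BddBelow C) : IsUpperSet C := by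
  obtain ⟨q, hq⟩ := hb
  have hpos : ∀ y ∈ C, 0 < F y := fun y hy => (component_subset hC hy :)
  have hseg : ∀ y ∈ C, ∀ i t, 0 ≤ (t - y i) * slopeAt F i y → update y i t ∈ C := by
    intro y hy i t ht
    have hcont : Continuous fun s : ℝ => update y i s := by fun_prop
    refine subset_of_eq_connectedComponentIn hC
      (isPreconnected_uIcc.image (fun s : ℝ => update y i s) hcont.continuousOn)
      (A := (fun s : ℝ => update y i s) '' Set.uIcc (y i) t) ?_
      ⟨y, ⟨y i, Set.left_mem_uIcc, by simp⟩, hy⟩ ⟨t, Set.right_mem_uIcc, rfl⟩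
    rintro _ ⟨s, hs, rfl⟩
    have := mul_nonneg_of_mem_uIcc ht hs
    have := hpos y hy
    simp only [Set.mem_ofPred_eq, hF.update_eq]
    linarith
  refine isUpperSet_of_update_mem fun y hy i t ht => ?_
  refine hseg y hy i t (mul_nonneg (by linarith) ?_)
  by_contra! hneg
  have hqi := hq hy i
  have := hq (hseg y hy i (q i - 1) (mul_nonneg_of_nonpos_of_nonpos (by linarith) hneg.le)) i
  simp at this
  linarith

/-- A zero slope would put an entire coordinate line into the component. -/
theorem slopeAt_ne_zero_of_zero_component (hF : IsMultiaffine F) {L : Set (ι → ℝ)} {x : ι → ℝ}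
    (hL : L = connectedComponentIn {y | F y = 0} x) (hb : BddBelow L) {y : ι → ℝ} (hy : y ∈ L)
    (i : ι) : slopeAt F i y ≠ 0 := by
  intro h0
  obtain ⟨q, hq⟩ := hb
  have hy0 : F y = 0 := (component_subset hL hy :)
  have hcont : Continuous fun s : ℝ => update y i s := by fun_prop
  have hsub : Set.range (fun s : ℝ => update y i s) ⊆ L := by
    refine subset_of_eq_connectedComponentIn hL (isPreconnected_range hcont) ?_
      ⟨y, ⟨y i, by simp⟩, hy⟩
    rintro _ ⟨s, rfl⟩
    simp [hF.update_eq, hy0, h0]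
  have := hq (hsub ⟨q i - 1, rfl⟩) i
  simp at this
  linarith

/-- A component of the zero set that is bounded below contains, with every point, the part of the
hyperbola branch through this point in a coordinate plane on which the slope keeps its sign. -/
theorem hyperbola_mem_of_zero_component (hF : IsMultiaffine F) {L : Set (ι → ℝ)} {x : ι → ℝ}
    (hL : L = connectedComponentIn {y | F y = 0} x) {y : ι → ℝ} (hy : y ∈ L)
    {i j : ι} (hij : i ≠ j) {t : ℝ} (hj : slopeAt F j y ≠ 0)
    (ht : 0 ≤ (t - y i) * (slopeAt (slopeAt F j) i y * slopeAt F j y)) :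
    update (update y i t) j
      (y j - (t - y i) * slopeAt F i y / slopeAt F j (update y i t)) ∈ L := by
  have hy0 : F y = 0 := (component_subset hL hy :)
  have hne : ∀ s ∈ Set.uIcc (y i) t, slopeAt F j (update y i s) ≠ 0 := by
    intro s hs h0
    rw [hF.slopeAt_update y hij] at h0
    have hst := mul_nonneg_of_mem_uIcc ht hs
    have hsq : 0 < slopeAt F j y * slopeAt F j y := mul_self_pos.2 hj
    have : slopeAt F j y * (slopeAt F j y + (s - y i) * slopeAt (slopeAt F j) i y) = 0 := by
      rw [h0, mul_zero]
    nlinarith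
  have hcont : ContinuousOn (fun s : ℝ => update (update y i s) j
      (y j - (s - y i) * slopeAt F i y / slopeAt F j (update y i s))) (Set.uIcc (y i) t) := by
    have h1 : ContinuousOn (fun s : ℝ => slopeAt F j (update y i s)) (Set.uIcc (y i) t) := by
      simp only [hF.slopeAt_update y hij]; fun_prop
    have h2 : ContinuousOn (fun s : ℝ => update y i s) (Set.uIcc (y i) t) := by fun_prop
    have h3 : ContinuousOn (fun s : ℝ => (s - y i) * slopeAt F i y) (Set.uIcc (y i) t) := by
      fun_prop
    exact fun s hs => (h2 s hs).update j ((continuousOn_const.sub (h3.div h1 hne)) s hs)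
  refine subset_of_eq_connectedComponentIn hL (isPreconnected_uIcc.image _ hcont) ?_
    ⟨y, ⟨y i, Set.left_mem_uIcc, by simp⟩, hy⟩ ⟨t, Set.right_mem_uIcc, rfl⟩
  rintro _ ⟨s, hs, rfl⟩
  have := hne s hs
  simp only [Set.mem_ofPred_eq]
  rw [hF.update_eq (update y i s) j, hF.update_eq y i s, update_of_ne hij.symm, hy0]
  field_simp
  ring

/-- Otherwise the hyperbola branch through y could be followed inside L with coordinate i going to
-∞. -/
theorem mixed_slope_pos_of_zero_component (hF : IsMultiaffine F) {L : Set (ι → ℝ)} {x : ι → ℝ}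
    (hL : L = connectedComponentIn {y | F y = 0} x) (hb : BddBelow L) {y : ι → ℝ} (hy : y ∈ L)
    {i j : ι} (hij : i ≠ j) : 0 < slopeAt (slopeAt F j) i y * slopeAt F j y := by
  by_contra! hle
  have hj := slopeAt_ne_zero_of_zero_component hF hL hb hy j
  obtain ⟨q, hq⟩ := hb
  have hqi := hq hy i
  have := hq (hyperbola_mem_of_zero_component hF hL hy hij hj (t := q i - 1)
    (mul_nonneg_of_nonpos_of_nonpos (by linarith) hle)) i
  simp [update_of_ne hij] at this
  linarith

/-- The mixed slope is symmetric in i and j, so the slopes at i and j share its sign; hence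
coordinate j falls as coordinate i rises along the branch. -/
theorem exists_update_mem_of_zero_component (hF : IsMultiaffine F) {L : Set (ι → ℝ)} {x : ι → ℝ}
    (hL : L = connectedComponentIn {y | F y = 0} x) (hb : BddBelow L) {y : ι → ℝ} (hy : y ∈ L)
    {i j : ι} (hij : i ≠ j) {t : ℝ} (ht : y i ≤ t) :
    ∃ r ≤ y j, update (update y i t) j r ∈ L := by
  have hj := slopeAt_ne_zero_of_zero_component hF hL hb hy j
  have hpj := mixed_slope_pos_of_zero_component hF hL hb hy hij
  have hpi := mixed_slope_pos_of_zero_component hF hL hb hy hij.symm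
  rw [slopeAt_comm F y hij.symm] at hpi
  refine ⟨_, ?_, hyperbola_mem_of_zero_component hF hL hy hij hj (t := t)
    (mul_nonneg (by linarith) hpj.le)⟩
  rw [hF.slopeAt_update y hij]
  have : 0 ≤ (t - y i) * slopeAt F i y /
      (slopeAt F j y + (t - y i) * slopeAt (slopeAt F j) i y) := by
    rcases pos_and_pos_or_neg_and_neg_of_mul_pos hpj with ⟨h1, h2⟩ | ⟨h1, h2⟩
    · have : 0 < slopeAt F i y := pos_of_mul_pos_right hpi h1.le
      exact div_nonneg (mul_nonneg (by linarith) this.le)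
        (add_nonneg h2.le (mul_nonneg (by linarith) h1.le))
    · have : slopeAt F i y < 0 := by by_contra! h; nlinarith
      exact div_nonneg_of_nonpos (mul_nonpos_of_nonneg_of_nonpos (by linarith) this.le)
        (add_nonpos h2.le (mul_nonpos_of_nonneg_of_nonpos (by linarith) h1.le))
  linarith

theorem exists_update_mem_of_le [Fintype ι] (hF : IsMultiaffine F) {L : Set (ι → ℝ)} {x : ι → ℝ}
    (hL : L = connectedComponentIn {y | F y = 0} x) (hb : BddBelow L) {y z : ι → ℝ} (hy : y ∈ L)
    (hyz : y ≤ z) (j : ι) : ∃ r ≤ y j, update z j r ∈ L := by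
  have key : ∀ T : Finset ι, ∃ r ≤ y j, update (T.piecewise z y) j r ∈ L := by
    intro T
    induction T using Finset.induction_on with
    | empty => exact ⟨y j, le_rfl, by simpa using hy⟩
    | insert i T hi ih =>
      obtain ⟨r, hr, hmem⟩ := ih
      rw [Finset.piecewise_insert]
      by_cases hij : i = j
      · subst hij
        exact ⟨r, hr, by simpa using hmem⟩
      · obtain ⟨r', hr', hmem'⟩ := exists_update_mem_of_zero_component hF hL hb hmem hij
          (t := z i) (by simpa [hi, hij] using hyz i)
        refine ⟨r', by simpa using hr'.trans (by simpa using hr), ?_⟩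
        rwa [update_comm (Ne.symm hij), update_idem] at hmem'
  simpa using key univ

/-- A component of the zero set that is bounded below has all slopes positive as soon as some
positive upper set exists. -/
theorem slopeAt_pos_of_zero_component [Fintype ι] (hF : IsMultiaffine F) (hc : Continuous F)
    {Γ : Set (ι → ℝ)} (hΓ : IsUpperSet Γ) (hne : Γ.Nonempty) (hΓF : ∀ z ∈ Γ, 0 < F z)
    {L : Set (ι → ℝ)} {x : ι → ℝ}
    (hL : L = connectedComponentIn {y | F y = 0} x) (hb : BddBelow L) {y : ι → ℝ} (hy : y ∈ L)
    (j : ι) : 0 < slopeAt F j y := by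
  obtain ⟨z₀, hz₀⟩ := hne
  set z := z₀ ⊔ y
  have hz : z ∈ Γ := hΓ le_sup_left hz₀
  obtain ⟨r, -, hr⟩ := exists_update_mem_of_le hF hL hb hy (le_sup_right : y ≤ z) j
  -- A negative slope on this line would produce a zero of F above z, inside the upper set where F
  -- is positive.
  have hpos : 0 < slopeAt F j (update z j r) := by
    refine lt_of_le_of_ne ?_ (slopeAt_ne_zero_of_zero_component hF hL hb hr j).symm
    rw [slopeAt_update_self]
    by_contra! hneg
    have hFz := hΓF z hz
    have hup : update z j (z j - F z / slopeAt F j z) ∈ Γ := by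
      refine hΓ (fun i => ?_) hz
      by_cases hij : i = j
      · subst hij
        have : F z / slopeAt F i z ≤ 0 := div_nonpos_of_nonneg_of_nonpos hFz.le hneg.le
        simp; exact this
      · simp [hij]
    have := hΓF _ hup
    rw [hF.update_eq] at this
    have hne' := hneg.ne
    have h0 : F z + (z j - F z / slopeAt F j z - z j) * slopeAt F j z = 0 := by
      field_simp; ring
    exact this.ne' h0
  -- The slope never vanishes on the connected set L, so its sign at one point is its sign
  -- everywhere.
  by_contra! hle
  have hcont : Continuous (slopeAt F j) := by
    unfold slopeAt; fun_prop
  have hpre : IsPreconnected L := hL ▸ isPreconnected_connectedComponentIn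
  obtain ⟨w, hw, hw0⟩ := hpre.intermediate_value hy hr hcont.continuousOn ⟨hle, hpos.le⟩
  exact slopeAt_ne_zero_of_zero_component hF hL hb hw j hw0

/-- Lowering coordinate j of z reaches a zero in L, and the slope in that direction is positive. -/
theorem pos_of_forall_lt_of_zero_component [Fintype ι] [Nonempty ι] (hF : IsMultiaffine F)
    (hc : Continuous F)
    {Γ : Set (ι → ℝ)} (hΓ : IsUpperSet Γ) (hne : Γ.Nonempty) (hΓF : ∀ z ∈ Γ, 0 < F z)
    {L : Set (ι → ℝ)} {x : ι → ℝ}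
    (hL : L = connectedComponentIn {y | F y = 0} x) (hb : BddBelow L) {y z : ι → ℝ} (hy : y ∈ L)
    (hyz : ∀ i, y i < z i) : 0 < F z := by
  let j := Classical.arbitrary ι
  obtain ⟨r, hr, hmem⟩ := exists_update_mem_of_le hF hL hb hy (fun i => (hyz i).le) j
  have h0 : F (update z j r) = 0 := (component_subset hL hmem :)
  have hs := slopeAt_pos_of_zero_component hF hc hΓ hne hΓF hL hb hmem j
  rw [slopeAt_update_self] at hs
  rw [hF.update_eq] at h0
  nlinarith [hyz j]

end Components

section Region

variable [Fintype ι] {c : ℝ} {a : Finset ι → ℝ} [Nonempty ι]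

theorem bddBelow_positiveRegion (ha : ∀ U, 0 ≤ a U) : BddBelow (positiveRegion c a) :=
  ⟨fun _ => -c, fun _ hx i => (neg_lt_of_mem_positiveRegion ha hx i).le⟩

theorem connectedComponentIn_eq_positiveRegion (ha : ∀ U, 0 ≤ a U)
    (hex : ∀ i, ∃ U : Finset ι, U.Nonempty ∧ i ∉ U ∧ 0 < a U) {x : ι → ℝ}
    (hx : x ∈ positiveRegion c a) :
    connectedComponentIn {y | 0 < penultimateComb c a y} x = positiveRegion c a := by
  refine Subset.antisymm ?_ ?_
  · refine isPreconnected_connectedComponentIn.subset_of_closure_inter_subset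
      isOpen_positiveRegion ⟨x, mem_connectedComponentIn hx.2, hx⟩ ?_
    rintro y ⟨hy, hyC⟩
    exact ⟨closure_positiveRegion_subset ha hex hy, (component_subset rfl hyC :)⟩
  · exact (convex_positiveRegion ha).isPreconnected.subset_connectedComponentIn hx
      fun y hy => hy.2

/-- Both sets are upper sets, so they share the supremum of a point of each. -/
theorem eq_positiveRegion_of_bddBelow (ha : ∀ U, 0 ≤ a U)
    (hex : ∀ i, ∃ U : Finset ι, U.Nonempty ∧ i ∉ U ∧ 0 < a U)
    (hne : (positiveRegion c a).Nonempty) {C : Set (ι → ℝ)} {x : ι → ℝ}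
    (hx : 0 < penultimateComb c a x)
    (hC : C = connectedComponentIn {y | 0 < penultimateComb c a y} x) (hb : BddBelow C) :
    C = positiveRegion c a := by
  have hup := isUpperSet_positive_component (isMultiaffine_penultimateComb c a) hC hb
  obtain ⟨z, hz⟩ := hne
  have hxC : x ∈ C := hC ▸ mem_connectedComponentIn hx
  have h1 : z ⊔ x ∈ C := hup le_sup_right hxC
  have h2 : z ⊔ x ∈ positiveRegion c a := isUpperSet_positiveRegion ha hex le_sup_left hz
  rw [← connectedComponentIn_eq_positiveRegion ha hex h2, hC]
  exact connectedComponentIn_eq (hC ▸ h1)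

theorem isPreconnected_frontier_positiveRegion (ha : ∀ U, 0 ≤ a U)
    (hex : ∀ i, ∃ U : Finset ι, U.Nonempty ∧ i ∉ U ∧ 0 < a U)
    (hne : (positiveRegion c a).Nonempty) : IsPreconnected (frontier (positiveRegion c a)) :=
  (isUpperSet_positiveRegion ha hex).isPreconnected_frontier isOpen_positiveRegion hne
    (bddBelow_positiveRegion ha)

theorem connectedComponentIn_eq_frontier (ha : ∀ U, 0 ≤ a U)
    (hex : ∀ i, ∃ U : Finset ι, U.Nonempty ∧ i ∉ U ∧ 0 < a U)
    (hne : (positiveRegion c a).Nonempty) {x : ι → ℝ}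
    (hx : x ∈ frontier (positiveRegion c a)) :
    connectedComponentIn {y | penultimateComb c a y = 0} x = frontier (positiveRegion c a) := by
  have hfr := frontier_positiveRegion (c := c) ha hex
  refine Subset.antisymm ?_ ?_
  · intro y hy
    by_contra hyn
    -- The frontier is relatively clopen in the zero set: it is closed, and it equals the trace of
    -- the open cone.
    obtain ⟨w, hw, hwD, hwn⟩ := isPreconnected_connectedComponentIn
      (x := x) (F := {y | penultimateComb c a y = 0}) (penultimateCone ι)
      (frontier (positiveRegion c a))ᶜ isOpen_penultimateCone isClosed_frontier.isOpen_compl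
      (fun w _ => by
        by_cases hw : w ∈ frontier (positiveRegion c a)
        · exact Or.inl (hfr ▸ hw).1
        · exact Or.inr hw)
      ⟨x, mem_connectedComponentIn (hfr ▸ hx).2, (hfr ▸ hx).1⟩ ⟨y, hy, hyn⟩
    exact hwn (hfr ▸ ⟨hwD, (component_subset rfl hw :)⟩)
  · exact (isPreconnected_frontier_positiveRegion ha hex hne).subset_connectedComponentIn hx
      fun y hy => (hfr ▸ hy).2

theorem eq_frontier_of_bddBelow (ha : ∀ U, 0 ≤ a U)
    (hex : ∀ i, ∃ U : Finset ι, U.Nonempty ∧ i ∉ U ∧ 0 < a U)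
    (hne : (positiveRegion c a).Nonempty) {L : Set (ι → ℝ)} {x : ι → ℝ}
    (hx : penultimateComb c a x = 0)
    (hL : L = connectedComponentIn {y | penultimateComb c a y = 0} x) (hb : BddBelow L) :
    L = frontier (positiveRegion c a) := by
  have hxL : x ∈ L := hL ▸ mem_connectedComponentIn hx
  have hΓ := isUpperSet_positiveRegion (c := c) ha hex
  -- The open orthant above x is connected, positive for f and meets the region, hence lies in it; x
  -- is in its closure.
  let A : Set (ι → ℝ) := Set.univ.pi fun i => Set.Ioi (x i)
  have hApos : A ⊆ {y | 0 < penultimateComb c a y} := fun z hz =>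
    pos_of_forall_lt_of_zero_component (isMultiaffine_penultimateComb c a)
      continuous_penultimateComb hΓ hne (fun w hw => hw.2) hL hb hxL
      fun i => hz i (Set.mem_univ i)
  have hAconv : Convex ℝ A := convex_pi fun i _ => convex_Ioi (x i)
  obtain ⟨z, hz⟩ := hne
  have hz' : z ⊔ (fun i => x i + 1) ∈ positiveRegion c a := hΓ le_sup_left hz
  have hAΓ : A ⊆ positiveRegion c a := by
    refine subset_of_eq_connectedComponentIn
      (connectedComponentIn_eq_positiveRegion ha hex hz').symm hAconv.isPreconnected hApos
      ⟨_, fun i _ => ?_, hz'⟩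
    exact lt_of_lt_of_le (lt_add_one (x i)) (le_sup_right (a := z i))
  have hxcl : x ∈ closure A := by
    rw [closure_pi_set]
    intro i _
    simp
  have hxfr : x ∈ frontier (positiveRegion c a) := by
    rw [isOpen_positiveRegion.frontier_eq]
    exact ⟨closure_mono hAΓ hxcl, fun h => h.2.ne' hx⟩
  rw [hL, connectedComponentIn_eq_frontier ha hex ⟨z, hz⟩ hxfr]

end Region

end

/-! ### Expansion of the σ_k in the p_U, symmetry, and the main theorem -/

section

open Finset

/-- Double counting: pairs (U, i) with i in U correspond to pairs (V, i) with i outside V = U \ {i}.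
-/
theorem sum_penultimate_powersetCard {ι : Type*} [DecidableEq ι] [Fintype ι] (k : ℕ)
    (hk : k ≤ Fintype.card ι) (x : ι → ℝ) :
    ∑ U ∈ powersetCard (k + 1) univ, penultimate U x =
      (Fintype.card ι - k : ℝ) * ∑ V ∈ powersetCard k univ, ∏ i ∈ V, x i := by
  have hright : (Fintype.card ι - k : ℝ) * ∑ V ∈ powersetCard k univ, ∏ i ∈ V, x i =
      ∑ V ∈ powersetCard k (univ : Finset ι), ∑ _i ∈ Vᶜ, ∏ i ∈ V, x i := by
    rw [mul_sum]
    refine sum_congr rfl fun V hV => ?_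
    rw [sum_const, card_compl, (mem_powersetCard.1 hV).2, nsmul_eq_mul, Nat.cast_sub hk]
  rw [hright]
  simp only [penultimate]
  rw [sum_sigma', sum_sigma']
  refine sum_bij' (fun p _ => ⟨p.1.erase p.2, p.2⟩) (fun p _ => ⟨insert p.2 p.1, p.2⟩) ?_ ?_ ?_ ?_ ?_
  · rintro ⟨U, i⟩ h
    simp only [mem_sigma, mem_powersetCard, subset_univ, true_and] at h
    simp [card_erase_of_mem h.2, h.1]
  · rintro ⟨V, i⟩ h
    simp only [mem_sigma, mem_powersetCard, subset_univ, true_and, mem_compl] at h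
    simp [card_insert_of_notMem h.2, h.1]
  · rintro ⟨U, i⟩ h
    simp only [mem_sigma] at h
    simp [insert_erase h.2]
  · rintro ⟨V, i⟩ h
    simp only [mem_sigma, mem_compl] at h
    simp [erase_insert h.2]
  · rintro ⟨U, i⟩ _
    rfl

/-- The weight of `penultimate U` in the expansion of `guanZhangPoly (m + 2) c`. -/
noncomputable def guanZhangWeight (m : ℕ) (c : ℕ → ℝ) (U : Finset (Fin (m + 2))) : ℝ :=
  -- The first condition drops U = univ, whose term carries c_{n-1}; the second drops ∅, where
  -- truncated subtraction would read index 0.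
  if #U - 1 < m + 1 ∧ U.Nonempty then c (#U - 1) / (m + 2 - (#U - 1 : ℕ)) else 0

theorem guanZhangWeight_nonneg {m : ℕ} {c : ℕ → ℝ} (hc : ∀ k ∈ range (m + 1), 0 ≤ c k)
    (U : Finset (Fin (m + 2))) : 0 ≤ guanZhangWeight m c U := by
  unfold guanZhangWeight
  split_ifs with h
  · have : ((#U - 1 : ℕ) : ℝ) < m + 1 := by exact_mod_cast h.1
    exact div_nonneg (hc _ (mem_range.2 h.1)) (by linarith)
  · exact le_rfl

theorem exists_guanZhangWeight_pos {m : ℕ} {c : ℕ → ℝ} (hsum : 0 < ∑ k ∈ range (m + 1), c k)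
    (i : Fin (m + 2)) :
    ∃ U : Finset (Fin (m + 2)), U.Nonempty ∧ i ∉ U ∧ 0 < guanZhangWeight m c U := by
  obtain ⟨k, hk, hpos⟩ := exists_lt_of_sum_lt (f := fun _ => (0 : ℝ)) (by simpa using hsum)
  have hk' : k < m + 1 := mem_range.1 hk
  -- The restriction k ≤ n-2 leaves room for k+1 indices different from i.
  obtain ⟨U, hU, hcard⟩ := exists_subset_card_eq (s := univ.erase i) (n := k + 1)
    (by rw [card_erase_of_mem (mem_univ i), card_univ, Fintype.card_fin]; omega)
  have hne : U.Nonempty := card_pos.1 (by omega)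
  refine ⟨U, hne, fun hi => by simpa using hU hi, ?_⟩
  have : (k : ℝ) < m + 1 := by exact_mod_cast hk'
  rw [guanZhangWeight, hcard, Nat.add_sub_cancel, if_pos ⟨hk', hne⟩]
  exact div_pos hpos (by linarith)

theorem eval_guanZhangPoly (m : ℕ) (c : ℕ → ℝ) (x : Fin (m + 2) → ℝ) :
    MvPolynomial.eval x (guanZhangPoly (m + 2) c) =
      penultimateComb (c (m + 1)) (guanZhangWeight m c) x := by
  have hes : ∀ k, MvPolynomial.eval x (MvPolynomial.esymm (Fin (m + 2)) ℝ k) =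
      ∑ V ∈ powersetCard k univ, ∏ i ∈ V, x i := by
    intro k
    simp [MvPolynomial.esymm]
  have hpen := fun k (hk : k ≤ m + 2) =>
    sum_penultimate_powersetCard (ι := Fin (m + 2)) k (by simpa using hk) x
  simp only [Fintype.card_fin, Nat.cast_add, Nat.cast_ofNat] at hpen
  have htop : ∑ V ∈ powersetCard (m + 1) (univ : Finset (Fin (m + 2))), ∏ i ∈ V, x i
      = penultimate univ x := by
    have h := hpen (m + 1) (by omega)
    have huniv : powersetCard (m + 1 + 1) (univ : Finset (Fin (m + 2))) = {univ} := by
      conv_rhs => rw [← powersetCard_self, card_univ, Fintype.card_fin]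
    rw [huniv, sum_singleton] at h
    rw [h]; push_cast; ring
  have hweights : ∑ U, guanZhangWeight m c U * penultimate U x =
      ∑ k ∈ range (m + 1), c k * ∑ V ∈ powersetCard k univ, ∏ i ∈ V, x i := by
    rw [← powerset_univ, sum_powerset, card_univ, Fintype.card_fin, sum_range_succ',
      sum_range_succ]
    rw [sum_eq_zero (s := powersetCard 0 univ), sum_eq_zero (s := powersetCard (m + 1 + 1) univ),
      add_zero, add_zero]
    · refine sum_congr rfl fun k hk => ?_
      have hk' : k < m + 1 := mem_range.1 hk
      have hpos : (0 : ℝ) < m + 2 - k := by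
        have : (k : ℝ) < m + 1 := by exact_mod_cast hk'
        linarith
      rw [← mul_right_inj' hpos.ne', mul_left_comm _ (c k), ← hpen k (by omega), mul_sum, mul_sum]
      refine sum_congr rfl fun U hU => ?_
      have hcard := (mem_powersetCard.1 hU).2
      rw [guanZhangWeight, hcard, Nat.add_sub_cancel, if_pos ⟨hk', card_pos.1 (by omega)⟩]
      field_simp
    · intro U hU
      have hcard := (mem_powersetCard.1 hU).2
      rw [guanZhangWeight, if_neg (by rw [hcard]; simp), zero_mul]
    · intro U hU
      have hcard := (mem_powersetCard.1 hU).2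
      rw [guanZhangWeight, if_neg (by rw [← card_pos, hcard]; simp), zero_mul]
  rw [guanZhangPoly, penultimateComb, hweights]
  simp only [map_add, map_sub, map_mul, map_prod, map_sum, MvPolynomial.eval_X, MvPolynomial.eval_C,
    hes, show m + 2 - 1 = m + 1 from rfl, htop]

theorem eval_diagonalRestriction {n : ℕ} (f : MvPolynomial (Fin n) ℝ) (t : ℝ) :
    (diagonalRestriction f).eval t = MvPolynomial.eval (fun _ => t) f := by
  induction f using MvPolynomial.induction_on with
  | C r => simp [diagonalRestriction]
  | add p q hp hq => simp_all [diagonalRestriction]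
  | mul_X p i hp => simp_all [diagonalRestriction]

theorem InOrthantTranslate.bddBelow {n : ℕ} {C : Set (Fin n → ℝ)} (h : InOrthantTranslate C) :
    BddBelow C := by
  obtain ⟨q, hq⟩ := h
  exact ⟨q, fun x hx i => (hq x hx i).le⟩

theorem BddBelow.inOrthantTranslate {n : ℕ} {C : Set (Fin n → ℝ)} (h : BddBelow C) :
    InOrthantTranslate C := by
  obtain ⟨q, hq⟩ := h
  exact ⟨fun i => q i - 1, fun x hx i => (sub_one_lt _).trans_le (hq hx i)⟩

theorem isComponentOf_frontier_and_unique {n : ℕ} [NeZero n] {c : ℝ} {a : Finset (Fin n) → ℝ}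
    (ha : ∀ U, 0 ≤ a U) (hex : ∀ i, ∃ U : Finset (Fin n), U.Nonempty ∧ i ∉ U ∧ 0 < a U)
    (hne : (positiveRegion c a).Nonempty) (hfr : (frontier (positiveRegion c a)).Nonempty)
    (L : Set (Fin n → ℝ)) :
    (IsComponentOf L {x | penultimateComb c a x = 0} ∧ InOrthantTranslate L) ↔
      L = frontier (positiveRegion c a) := by
  constructor
  · rintro ⟨⟨x, hx, hL⟩, hb⟩
    exact eq_frontier_of_bddBelow ha hex hne hx hL hb.bddBelow
  · rintro rfl
    obtain ⟨x, hx⟩ := hfr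
    have hbb : BddBelow (closure (positiveRegion c a)) := by
      rw [bddBelow_closure]; exact bddBelow_positiveRegion ha
    refine ⟨⟨x, ?_, (connectedComponentIn_eq_frontier ha hex hne hx).symm⟩,
      (hbb.mono frontier_subset_closure).inOrthantTranslate⟩
    rw [frontier_positiveRegion ha hex] at hx
    exact hx.2

theorem penultimate_comp_perm {ι : Type*} [DecidableEq ι] (s : Equiv.Perm ι) (T : Finset ι)
    (x : ι → ℝ) : penultimate T (x ∘ s) = penultimate (T.map s.toEmbedding) x := by
  simp only [penultimate, sum_map]
  refine sum_congr rfl fun i _ => ?_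
  rw [← map_erase, prod_map]
  rfl

theorem comp_perm_mem_penultimateCone {ι : Type*} [DecidableEq ι] (s : Equiv.Perm ι) {x : ι → ℝ}
    (hx : x ∈ penultimateCone ι) : x ∘ s ∈ penultimateCone ι := fun T hT => by
  rw [penultimate_comp_perm]
  exact hx _ (by simpa using hT)

theorem guanZhangWeight_map (m : ℕ) (c : ℕ → ℝ) (s : Equiv.Perm (Fin (m + 2)))
    (U : Finset (Fin (m + 2))) :
    guanZhangWeight m c (U.map s.toEmbedding) = guanZhangWeight m c U := by
  simp [guanZhangWeight]

theorem penultimateComb_comp_perm {ι : Type*} [DecidableEq ι] [Fintype ι] {c : ℝ}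
    {a : Finset ι → ℝ} (s : Equiv.Perm ι) (ha : ∀ U, a (U.map s.toEmbedding) = a U) (x : ι → ℝ) :
    penultimateComb c a (x ∘ s) = penultimateComb c a x := by
  simp only [penultimateComb, penultimate_comp_perm, Function.comp_apply]
  rw [Equiv.prod_comp s, map_univ_equiv]
  congr 1
  rw [← Equiv.sum_comp s.finsetCongr (fun U => a U * penultimate U x)]
  exact sum_congr rfl fun U _ => by rw [Equiv.finsetCongr_apply, ha]

theorem frontier_positiveRegion_subset_upsilonOne {n : ℕ} [NeZero n] {c : ℝ}
    {a : Finset (Fin n) → ℝ} (ha : ∀ U, 0 ≤ a U)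
    (hex : ∀ i, ∃ U : Finset (Fin n), U.Nonempty ∧ i ∉ U ∧ 0 < a U)
    (hperm : ∀ (s : Equiv.Perm (Fin n)) (U : Finset (Fin n)), a (U.map s.toEmbedding) = a U) :
    frontier (positiveRegion c a) ⊆ upsilonOne (positiveRegion c a) := by
  intro μ hμ s
  rw [frontier_positiveRegion ha hex] at hμ
  obtain ⟨hD, h0⟩ := hμ
  have hlt : n - 1 < n := Nat.sub_lt (NeZero.pos n) one_pos
  let l : Fin n := ⟨n - 1, hlt⟩
  -- Raising only the coordinate that the projection forgets moves the permuted zero into the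
  -- region.
  refine ⟨Function.update (μ ∘ s) l (μ (s l) + 1), ?_, fun i hi => ?_⟩
  · refine mem_positiveRegion_of_lt ha hex (comp_perm_mem_penultimateCone s hD)
      (penultimateComb_comp_perm s (hperm s) μ ▸ h0.ge) ?_
    exact lt_update_self_iff.2 (lt_add_one _)
  · have : i ≠ l := fun h => by rw [h] at hi; simp only [l] at hi; omega
    simp [Function.update_of_ne this]

end

theorem mainTheorem8 (n : ℕ) (c : ℕ → ℝ)
    (hc : ∀ k ∈ Finset.range (n - 1), 0 ≤ c k)
    (hsum : 0 < ∑ k ∈ Finset.range (n - 1), c k) :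
    -- the diagonal restriction
    IsStrictlyRightNoetherian (diagonalRestriction (guanZhangPoly n c)) ∧
    (∃ x₀, IsGreatest {x | (diagonalRestriction (guanZhangPoly n c)).IsRoot x} x₀ ∧ 0 < x₀) ∧
    -- the level set is the boundary of a convex region
    ∃ Γ : Set (Fin n → ℝ),
      IsStrictlyUpsilonStable (guanZhangPoly n c) Γ ∧
      (∀ Γ', IsUpsilonStable (guanZhangPoly n c) Γ' → Γ' = Γ) ∧
      (∀ L, (IsComponentOf L (zeroSet (guanZhangPoly n c)) ∧ InOrthantTranslate L) ↔
        L = frontier Γ) ∧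
      Convex ℝ Γ := by
  obtain ⟨m, rfl⟩ : ∃ m, n = m + 2 := by
    rcases n with _ | _ | m
    · simp at hsum
    · simp at hsum
    · exact ⟨m, rfl⟩
  simp only [show m + 2 - 1 = m + 1 from rfl] at hc hsum
  have hp := isSignedPoly_diagonalRestriction m c hc
  obtain ⟨x₀, hx₀, hroot⟩ := hp.exists_pos_root (exists_coeff_diagonalRestriction_neg m c hsum)
  have hafter := fun y (hy : x₀ < y) => IsSignedPoly.pos_of_root_lt hp hx₀ hroot hy
  refine ⟨⟨hp.isRightNoetherian, x₀, hroot, fun y hy => ?_⟩, ⟨x₀, ⟨hroot, fun y hy => ?_⟩, hx₀⟩, ?_⟩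
  · by_contra! hle
    have hnonneg : 0 ≤ (diagonalRestriction (guanZhangPoly (m + 2) c)).eval y := by
      rcases hle.eq_or_lt with rfl | hlt
      · exact hroot.ge
      · exact (hafter y hlt).le
    exact (IsSignedPoly.derivative_pos hp (hx₀.trans_le hle) hnonneg).ne' hy
  · by_contra! hlt
    exact (hafter y hlt).ne' hy
  have ha := guanZhangWeight_nonneg hc
  have hex := exists_guanZhangWeight_pos hsum
  have hpos : positiveSet (guanZhangPoly (m + 2) c) =
      {x | 0 < penultimateComb (c (m + 1)) (guanZhangWeight m c) x} := by
    ext x; simp only [positiveSet, eval_guanZhangPoly]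
  have hzero : zeroSet (guanZhangPoly (m + 2) c) =
      {x | penultimateComb (c (m + 1)) (guanZhangWeight m c) x = 0} := by
    ext x; simp only [zeroSet, eval_guanZhangPoly]
  have hne : (positiveRegion (c (m + 1)) (guanZhangWeight m c)).Nonempty := by
    -- Positive diagonal points lie in the cone, so the largest root x₀ of r_f locates a point of
    -- the region here and a frontier point below.
    refine ⟨fun _ => x₀ + 1, mem_penultimateCone_of_pos fun _ => by linarith, ?_⟩
    rw [← eval_guanZhangPoly, ← eval_diagonalRestriction]
    exact hafter _ (lt_add_one x₀)
  have hfr : (frontier (positiveRegion (c (m + 1)) (guanZhangWeight m c))).Nonempty := by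
    refine ⟨fun _ => x₀, ?_⟩
    rw [frontier_positiveRegion ha hex]
    refine ⟨mem_penultimateCone_of_pos fun _ => hx₀, ?_⟩
    rw [← eval_guanZhangPoly, ← eval_diagonalRestriction]
    exact hroot
  refine ⟨positiveRegion (c (m + 1)) (guanZhangWeight m c), ⟨⟨?_, ?_⟩, ?_⟩, ?_, ?_, ?_⟩
  · obtain ⟨z, hz⟩ := hne
    rw [hpos]
    exact ⟨z, hz.2, (connectedComponentIn_eq_positiveRegion ha hex hz).symm⟩
  · exact (bddBelow_positiveRegion ha).inOrthantTranslate
  · exact frontier_positiveRegion_subset_upsilonOne ha hex (guanZhangWeight_map m c)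
  · rintro Γ' ⟨⟨x, hx, hC⟩, hb⟩
    rw [hpos] at hx hC
    exact eq_positiveRegion_of_bddBelow ha hex hne hx hC hb.bddBelow
  · intro L
    rw [hzero]
    exact isComponentOf_frontier_and_unique ha hex hne hfr L
  · exact convex_positiveRegion ha
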